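/- Let $\mathbb{K}$ be a field, let $R=\mathbb{K}[x_1,\dots,x_n]$, and let $M,N\in R$ be monomials of the same degree $d\ge 1$. For a monomial $m$ divisible by $x_j$ and $i<j$, the monomial $m'=\frac{x_i}{x_j}m$ is said to be obtained from $m$ by a Borel move, and $m$ from $m'$ by the corresponding reverse Borel move. A monomial ideal is Borel if it is closed under Borel moves, and $\operatorname{Borel}(B)$ denotes the smallest Borel ideal containing a set $B$ of monomials. Let $I=\operatorname{Borel}(M,N)$. (If $M$ and $N$ are the two Borel generators of $I$, this is the general equigenerated two-Borel ideal; the degenerate case in which one of $M,N$ lies in the Borel ideal generated by the other is allowed.) Let $\operatorname{gens}(I)$ be the set of minimal monomial generators of $I$, let $S_I=\mathbb{K}[Y_w : w\in\operatorname{gens}(I)]$, let $T(I)$ be the toric ideal of $I$, i.e. the kernel of the $\mathbb{K}$-algebra map $\phi:S_I\to R$, $Y_w\mapsto w$, and let $\mathbb{K}[I]=S_I/T(I)$ be the toric ring, graded by $\deg Y_w=1$. Put $G_M=\operatorname{gens}(\operatorname{Borel}(M))$ and $G_N=\operatorname{gens}(I)\smallsetminus G_M$. List the variables $Y_w$ as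 follows: first those with $w\in G_N$ in antilex order (lex-smallest $w$ first), then those with $w\in G_M$ in lex order (lex-largest $w$ first), where lex is taken with $x_1>x_2>\dots>x_n$. The fiber sink order $\prec$ is the (graded) reverse lexicographic monomial order on $S_I$ in which the variables earlier in this list are larger. Then: 1. $T(I)$ has a (finite) Gröbner basis with respect to the fiber sink order consisting of quadric binomials, i.e. of differences of two distinct monomials of degree two in the variables $Y_w$. 2. The toric ring $\mathbb{K}[I]$ is Koszul: with $A=\mathbb{K}[I]$ and $A_+$ its ideal generated by the elements of positive degree, the residue field $A/A_+\cong\mathbb{K}$ has a linear free resolution over $A$. 3. For a monomial $\mu$ of $R$, let $\vec\Gamma_\mu$ be the directed graph whose vertices are the monomials $Z$ of $S_I$ with $\phi(Z)=\mu$, where two distinct vertices are joined by an edge whenever one is obtained from the other by performing a Borel move on (the index of) one of its factors and the corresponding reverse Borel move on another factor, and where each edge is directed towards its $\prec$-smaller endpoint. Whenever $\vec\Gamma_\mu$ is nonempty, it has a unique sink, i.e. exactly one vertex without outgoing edges. -/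

import Mathlib

/-!
Monomials of `K[x_1, …, x_n]` are represented by their exponent vectors `Fin n →₀ ℕ`; the monomial
with exponent vector `m` is `MvPolynomial.monomial m 1`, products of monomials are sums of exponent
vectors, and divisibility is `≤`.
-/

namespace TwoBorel

noncomputable section

/-! ### Borel ideals -/

/-- `m'` is obtained from the monomial `m` by the Borel move replacing `x_j` with `x_i`, where
`i < j` and `x_j` divides `m`: `m' = (x_i / x_j) m`. (As `i ≠ j`, the equation forces
`m j = m' j + 1`, so `x_j` does divide `m`.) Equivalently, `m` is obtained from `m'` by the reverse
Borel move replacing `x_i` with `x_j`. -/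
def IsBorelMove {n : ℕ} (i j : Fin n) (m m' : Fin n →₀ ℕ) : Prop :=
  i < j ∧ m' + Finsupp.single j 1 = m + Finsupp.single i 1

/-- An ideal of a polynomial ring generated by monomials. -/
def IsMonomialIdeal {σ K : Type*} [Field K] (I : Ideal (MvPolynomial σ K)) : Prop :=
  ∃ s : Set (σ →₀ ℕ), I = Ideal.span ((fun m => MvPolynomial.monomial m (1 : K)) '' s)

/-- A Borel ideal: a monomial ideal closed under Borel moves. -/
structure IsBorel {n : ℕ} {K : Type*} [Field K] (I : Ideal (MvPolynomial (Fin n) K)) : Prop where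
  isMonomialIdeal : IsMonomialIdeal I
  borelMove_mem : ∀ (i j : Fin n) (m m' : Fin n →₀ ℕ), IsBorelMove i j m m' →
    MvPolynomial.monomial m (1 : K) ∈ I → MvPolynomial.monomial m' (1 : K) ∈ I

/-- `Borel(B)`: the smallest Borel ideal containing the monomials in `B`. -/
def borelIdeal {n : ℕ} (K : Type*) [Field K] (B : Set (Fin n →₀ ℕ)) :
    Ideal (MvPolynomial (Fin n) K) :=
  sInf {J | IsBorel J ∧ ∀ m ∈ B, MvPolynomial.monomial m (1 : K) ∈ J}

/-- `borelIdeal K B` is indeed a Borel ideal, so it is the smallest one containing `B`. -/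
theorem isBorel_borelIdeal {n : ℕ} (K : Type*) [Field K] (B : Set (Fin n →₀ ℕ)) :
    IsBorel (borelIdeal K B) := by
  refine ⟨⟨{m | MvPolynomial.monomial m (1 : K) ∈ borelIdeal K B}, le_antisymm ?_ ?_⟩, ?_⟩
  · intro f hf
    rw [MvPolynomial.mem_ideal_span_monomial_image]
    refine fun e he => ⟨e, ?_, le_rfl⟩
    refine Submodule.mem_sInf.2 fun J hJ => ?_
    obtain ⟨s, rfl⟩ := hJ.1.isMonomialIdeal
    have hfJ := Submodule.mem_sInf.1 hf _ hJ
    rw [MvPolynomial.mem_ideal_span_monomial_image] at hfJ ⊢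
    intro e' he'
    have : e' = e := by
      have := MvPolynomial.support_monomial_subset he'
      simpa using this
    subst this
    exact hfJ _ he
  · rw [Ideal.span_le]
    rintro _ ⟨m, hm, rfl⟩
    exact hm
  · intro i j m m' h hm
    exact Submodule.mem_sInf.2 fun J hJ =>
      hJ.1.borelMove_mem i j m m' h (Submodule.mem_sInf.1 hm J hJ)

/-- The minimal monomial generators of a monomial ideal: the monomials in `I` that are minimal with
respect to divisibility. -/
def gens {n : ℕ} {K : Type*} [Field K] (I : Ideal (MvPolynomial (Fin n) K)) :
    Set (Fin n →₀ ℕ) :=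
  {w | Minimal (fun m => MvPolynomial.monomial m (1 : K) ∈ I) w}

instance finite_gens {n : ℕ} {K : Type*} [Field K] (I : Ideal (MvPolynomial (Fin n) K)) :
    Finite (gens I) :=
  (WellQuasiOrderedLE.finite_of_isAntichain (setOfPred_minimal_antichain _)).to_subtype

/-! ### Toric ideals and toric rings -/

/-- The ring `S_I = K[Y_w : w ∈ gens I]`. -/
abbrev ToricSource {n : ℕ} {K : Type*} [Field K] (I : Ideal (MvPolynomial (Fin n) K)) : Type _ :=
  MvPolynomial (gens I) K

/-- The toric map `S_I → K[x_1, …, x_n]`, `Y_w ↦ w`. -/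
def toricMap {n : ℕ} {K : Type*} [Field K] (I : Ideal (MvPolynomial (Fin n) K)) :
    ToricSource I →ₐ[K] MvPolynomial (Fin n) K :=
  MvPolynomial.aeval fun w : gens I => MvPolynomial.monomial (w : Fin n →₀ ℕ) (1 : K)

/-- The toric ideal `T(I)`. -/
def toricIdeal {n : ℕ} {K : Type*} [Field K] (I : Ideal (MvPolynomial (Fin n) K)) :
    Ideal (ToricSource I) :=
  RingHom.ker (toricMap I)

/-- The toric ring `K[I] = S_I / T(I)`. -/
abbrev ToricRing {n : ℕ} {K : Type*} [Field K] (I : Ideal (MvPolynomial (Fin n) K)) : Type _ :=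
  ToricSource I ⧸ toricIdeal I

/-- The standard grading of the toric ring, in which every `Y_w` has degree one: the component of
degree `k` consists of the classes of the homogeneous polynomials of degree `k` in the `Y_w`. -/
def toricGrading {n : ℕ} {K : Type*} [Field K] (I : Ideal (MvPolynomial (Fin n) K)) (k : ℕ) :
    Submodule K (ToricRing I) :=
  (MvPolynomial.homogeneousSubmodule (gens I) K k).map
    (Ideal.Quotient.mkₐ K (toricIdeal I)).toLinearMap

/-! ### Koszul algebras -/

/-- The ideal `A_+` generated by the homogeneous elements of positive degree. -/
def positivePart {K A : Type*} [Field K] [CommRing A] [Algebra K A] (𝒜 : ℕ → Submodule K A) :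
    Ideal A :=
  Ideal.span (⋃ k : ℕ, (𝒜 (k + 1) : Set A))

/-- The residue field `A / A_+` has a linear free resolution
`⋯ → A(-2)^{b_2} → A(-1)^{b_1} → A^{b_0} → A / A_+ → 0` over `A`: an exact complex of finite free
modules whose differentials are given by matrices with entries in `𝒜 1`. -/
def HasLinearResolution {K A : Type*} [Field K] [CommRing A] [Algebra K A]
    (𝒜 : ℕ → Submodule K A) : Prop :=
  ∃ (b : ℕ → ℕ) (d : ∀ p : ℕ, Matrix (Fin (b p)) (Fin (b (p + 1))) A)
    (ε : (Fin (b 0) → A) →ₗ[A] (A ⧸ positivePart 𝒜)),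
    (∀ p r c, d p r c ∈ 𝒜 1) ∧
    Function.Surjective ε ∧
    Function.Exact (d 0).mulVecLin ε ∧
    ∀ p, Function.Exact (d (p + 1)).mulVecLin (d p).mulVecLin

/-- The commutative `K`-algebra `A`, with the grading `A = ⨁ 𝒜 k`, is Koszul: `𝒜` is a grading of
the `K`-algebra `A` with `𝒜 0 = K`, and the residue field `A / A_+` has a linear resolution. -/
structure IsKoszul {K A : Type*} [Field K] [CommRing A] [Algebra K A]
    (𝒜 : ℕ → Submodule K A) : Prop where
  nontrivial : Nontrivial A
  gradedMonoid : SetLike.GradedMonoid 𝒜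
  isInternal : DirectSum.IsInternal 𝒜
  zero_eq : 𝒜 0 = LinearMap.range (Algebra.linearMap K A)
  hasLinearResolution : HasLinearResolution 𝒜

/-! ### Graded reverse lexicographic orders and Gröbner bases -/

/-- A copy of the monomials `σ →₀ ℕ`, to be ordered by the graded reverse lexicographic order. -/
def DegRevLex (σ : Type*) : Type _ := σ →₀ ℕ

/-- The identity map. -/
def ofDegRevLex {σ : Type*} : DegRevLex σ ≃ (σ →₀ ℕ) := Equiv.refl _

instance (σ : Type*) : AddCommMonoid (DegRevLex σ) := ofDegRevLex.addCommMonoid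

theorem ofDegRevLex_add {σ : Type*} (a b : DegRevLex σ) :
    ofDegRevLex (a + b) = ofDegRevLex a + ofDegRevLex b := rfl

/-- Monomials are compared first by their degree, and then by the reversed colexicographic order of
their exponent vectors. -/
def DegRevLex.key {σ : Type*} (a : DegRevLex σ) : ℕ ×ₗ (Colex (σ →₀ ℕ))ᵒᵈ :=
  toLex ((ofDegRevLex a).degree, OrderDual.toDual (toColex (ofDegRevLex a)))

theorem DegRevLex.key_injective {σ : Type*} :
    Function.Injective (DegRevLex.key : DegRevLex σ → ℕ ×ₗ (Colex (σ →₀ ℕ))ᵒᵈ) := by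
  intro a b h
  simpa [DegRevLex.key] using congrArg (fun p => (ofLex p).2) h

instance (σ : Type*) [LinearOrder σ] : LinearOrder (DegRevLex σ) :=
  LinearOrder.lift' DegRevLex.key DegRevLex.key_injective

theorem DegRevLex.lt_iff {σ : Type*} [LinearOrder σ] {a b : DegRevLex σ} :
    a < b ↔ (ofDegRevLex a).degree < (ofDegRevLex b).degree ∨
      ((ofDegRevLex a).degree = (ofDegRevLex b).degree ∧
        ∃ i, (∀ j, i < j → ofDegRevLex a j = ofDegRevLex b j) ∧
          ofDegRevLex b i < ofDegRevLex a i) := by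
  change DegRevLex.key a < DegRevLex.key b ↔ _
  unfold DegRevLex.key
  rw [Prod.Lex.toLex_lt_toLex]
  refine or_congr Iff.rfl (and_congr Iff.rfl ?_)
  change toColex (ofDegRevLex b) < toColex (ofDegRevLex a) ↔ _
  rw [Finsupp.Colex.lt_iff]
  exact exists_congr fun i => and_congr (forall₂_congr fun j _ => eq_comm) Iff.rfl

instance (σ : Type*) [LinearOrder σ] : IsOrderedAddMonoid (DegRevLex σ) where
  add_le_add_left a b h c := by
    rcases h.eq_or_lt with rfl | h
    · exact le_rfl
    · refine le_of_lt ?_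
      rw [DegRevLex.lt_iff] at h ⊢
      simpa [ofDegRevLex_add] using h

theorem DegRevLex.le_of_le {σ : Type*} [LinearOrder σ] {a b : DegRevLex σ}
    (h : ofDegRevLex a ≤ ofDegRevLex b) : a ≤ b := by
  rcases h.eq_or_lt with h | h
  · exact (ofDegRevLex.injective h).le
  · refine le_of_lt (DegRevLex.lt_iff.2 (Or.inl ?_))
    obtain ⟨c, hc⟩ := le_iff_exists_add.1 h.le
    have hc0 : c ≠ 0 := by
      rintro rfl
      simp [hc] at h
    rw [hc, map_add]
    have : c.degree ≠ 0 := by simpa [Finsupp.degree_eq_zero_iff] using hc0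
    omega

instance (σ : Type*) [LinearOrder σ] [Finite σ] : WellFoundedLT (DegRevLex σ) := by
  have h : WellQuasiOrderedLE (DegRevLex σ) := ⟨fun f => by
    obtain ⟨m, k, hmk, hle⟩ := wellQuasiOrdered_le (fun t => ofDegRevLex (f t))
    exact ⟨m, k, hmk, DegRevLex.le_of_le hle⟩⟩
  exact WellQuasiOrderedLE.to_wellFoundedLT

/-- The graded reverse lexicographic monomial order in the variables `Y_s`, `s : σ`, where the
variables are listed in increasing order of `s`, so that the first variable is the largest one.
See `degRevLex_lt_iff` for the explicit description. -/
def degRevLex (σ : Type*) [LinearOrder σ] [Finite σ] : MonomialOrder σ where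
  syn := DegRevLex σ
  toSyn := { toEquiv := ofDegRevLex.symm, map_add' := fun _ _ => rfl }
  toSyn_monotone _ _ h := DegRevLex.le_of_le h

/-- `Y^a` is smaller than `Y^b` if it has smaller degree or if the degrees agree and, at the last
variable at which the exponents differ, `a` has the larger exponent. -/
theorem degRevLex_lt_iff {σ : Type*} [LinearOrder σ] [Finite σ] (a b : σ →₀ ℕ) :
    (degRevLex σ).toSyn a < (degRevLex σ).toSyn b ↔
      a.degree < b.degree ∨
        (a.degree = b.degree ∧ ∃ i, (∀ j, i < j → a j = b j) ∧ b i < a i) :=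
  DegRevLex.lt_iff

/-- `G` is a Gröbner basis of the ideal `J` with respect to the monomial order `ord`: a finite
subset of `J` whose leading terms generate the ideal of all leading terms of elements of `J`. -/
structure IsGroebnerBasis {σ K : Type*} [Field K] (ord : MonomialOrder σ)
    (G : Set (MvPolynomial σ K)) (J : Ideal (MvPolynomial σ K)) : Prop where
  finite : G.Finite
  subset : G ⊆ J
  span_leadingTerm : Ideal.span (ord.leadingTerm '' G) =
    Ideal.span (ord.leadingTerm '' (J : Set (MvPolynomial σ K)))

/-- A quadric binomial: a difference of two distinct monomials of degree two. -/
def IsQuadricBinomial {σ K : Type*} [Field K] (f : MvPolynomial σ K) : Prop :=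
  ∃ a b : σ →₀ ℕ, a.degree = 2 ∧ b.degree = 2 ∧ a ≠ b ∧
    f = MvPolynomial.monomial a 1 - MvPolynomial.monomial b 1

/-! ### The fiber sink order -/

open Classical in
/-- The position of a monomial `w` in the list which first has the monomials outside
`G_M = gens (Borel(M))` in antilex order, and then those of `G_M` in lex order. Here the lex order
lists the monomials of a given degree starting with `x_1^d`, that is, in *decreasing* order with
respect to the order relation of Mathlib's `Lex`. -/
def fiberSinkKey {n : ℕ} (K : Type*) [Field K] (M : Fin n →₀ ℕ) (w : Fin n →₀ ℕ) :
    Lex (Fin n →₀ ℕ) ⊕ₗ (Lex (Fin n →₀ ℕ))ᵒᵈ :=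
  if w ∈ gens (borelIdeal K {M}) then toLex (Sum.inr (OrderDual.toDual (toLex w)))
  else toLex (Sum.inl (toLex w))

theorem fiberSinkKey_injective {n : ℕ} (K : Type*) [Field K] (M : Fin n →₀ ℕ) :
    Function.Injective (fiberSinkKey K M) := by
  intro u v h
  unfold fiberSinkKey at h
  split_ifs at h <;> simp at h <;> exact h

/-- The fiber sink variable order on the variables `Y_w`, `w ∈ gens (Borel(M, N))`, as the linear
order in which `u < v` means that `Y_u` precedes `Y_v`: first the elements of
`G_N = gens (Borel(M, N)) \ G_M` in antilex order, then the elements of `G_M = gens (Borel(M))` in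
lex order. -/
abbrev fiberSinkVarOrder {n : ℕ} (K : Type*) [Field K] (M N : Fin n →₀ ℕ) :
    LinearOrder (gens (borelIdeal K {M, N})) :=
  LinearOrder.lift' (fun w : gens (borelIdeal K {M, N}) => fiberSinkKey K M w)
    ((fiberSinkKey_injective K M).comp Subtype.val_injective)

/-- The fiber sink order on `S_I`, `I = Borel(M, N)`: the reverse lexicographic monomial order
induced by the fiber sink variable order. -/
def fiberSinkOrder {n : ℕ} (K : Type*) [Field K] (M N : Fin n →₀ ℕ) :
    MonomialOrder (gens (borelIdeal K {M, N})) :=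
  @degRevLex (gens (borelIdeal K {M, N})) (fiberSinkVarOrder K M N) _

/-! ### Fiber graphs -/

/-- The monomials of `S_I` of multidegree `μ`. -/
def fiber {n : ℕ} {K : Type*} [Field K] (I : Ideal (MvPolynomial (Fin n) K)) (μ : Fin n →₀ ℕ) :
    Set (gens I →₀ ℕ) :=
  {Z | toricMap I (MvPolynomial.monomial Z 1) = MvPolynomial.monomial μ 1}

/-- The fiber graph of `I` at `μ`: two distinct monomials `Z`, `Z'` of multidegree `μ` are adjacent
if one of them is obtained from the other by a Borel move on one factor and the corresponding
reverse Borel move on another factor. -/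
def fiberGraph {n : ℕ} {K : Type*} [Field K] (I : Ideal (MvPolynomial (Fin n) K))
    (μ : Fin n →₀ ℕ) : SimpleGraph (fiber I μ) :=
  SimpleGraph.fromRel fun Z Z' =>
    ∃ (i j : Fin n) (Q : gens I →₀ ℕ) (w₁ w₂ w₁' w₂' : gens I),
      (Z : gens I →₀ ℕ) = Q + Finsupp.single w₁ 1 + Finsupp.single w₂ 1 ∧
      (Z' : gens I →₀ ℕ) = Q + Finsupp.single w₁' 1 + Finsupp.single w₂' 1 ∧
      IsBorelMove i j (w₁ : Fin n →₀ ℕ) w₁' ∧ IsBorelMove i j (w₂' : Fin n →₀ ℕ) w₂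

/-- The directed fiber graph: every edge of the fiber graph is directed towards its smaller
endpoint with respect to the monomial order `ord`. -/
def fiberDigraph {n : ℕ} {K : Type*} [Field K] (I : Ideal (MvPolynomial (Fin n) K))
    (ord : MonomialOrder (gens I)) (μ : Fin n →₀ ℕ) : Digraph (fiber I μ) where
  Adj Z Z' := (fiberGraph I μ).Adj Z Z' ∧
    ord.toSyn (Z' : gens I →₀ ℕ) < ord.toSyn (Z : gens I →₀ ℕ)

/-- A sink of a directed graph: a vertex without outgoing edges. -/
def IsSink {V : Type*} (D : Digraph V) (v : V) : Prop :=
  ∀ w, ¬ D.Adj v w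

end

end TwoBorel

/-!
Write `P_t(w)` for the degree of a monomial `w` in its first `t` variables (`prefixDegree`). The
generators of `Borel(M, N)` are the monomials `w` of degree `d` with `P_t(M) ≤ P_t(w)` for all `t`
or `P_t(N) ≤ P_t(w)` for all `t` (`mem_gens_pair_iff`), and a Borel move raises `P_t` by one on an
interval of values of `t`.

*Unique sinks.* A fiber move that creates a factor coming later in the variable order than every
factor of `Z` makes `Z` smaller (`fiberSinkOrder_lt_of_forall_lt`). Let `w` be the last factor of a
sink `Z`, and `μ` the multidegree of `Z`.
If `w` lies in `G_M`, the moves that would make `w` smaller in the lex order are blocked only by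
`w ∈ Borel(M)`. Hence `w` is the least divisor of `μ` in `G_M` in the Borel order
(`IsReduced.borelLE_of_borelLE`), whatever the other factors are.
If `w` lies in `G_N`, the moves that would make `w` larger are blocked only by the other factors,
so that these attain the bound `P_j(N)` for every variable `x_j` of `w`
(`IsReduced.prefixDegree_multidegree_eq`). On the one hand, this makes `w` the largest factor in the
Borel order that can occur in a monomial of multidegree `μ` with all factors in `G_N`
(`IsReduced.borelLE_of_not_borelLE`). On the other hand, comparing `P_t(μ)` for the last `t` with
`P_t(w) < P_t(M)` shows that no monomial of multidegree `μ` has a factor in `G_M`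
(`IsReduced.not_borelLE`).
So `μ` determines `w`, and induction on the number of factors applies
(`IsReduced.eq_of_multidegree_eq`).

*Gröbner basis.* The unique sink of a fiber is its smallest monomial. The leading monomial of an
element of the toric ideal is not the smallest one of its fiber, so it admits a decreasing fiber
move, that is, it is divisible by the leading monomial of a quadric binomial of the toric ideal
(`exists_quadricBinomial_degree_le`).

*Koszul property.* Any homogeneous ideal `J` with an initial ideal generated by quadrics has a Koszul
quotient (`IsQuadratic.isKoszul`). The resolution is built one step at a time: with free modules
ordered as in Schreyer's theorem, the leading terms of each syzygy module, modulo those in the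
initial ideal of `J`, are generated by terms `x_t e` of degree one, and this property passes to the
syzygies of the generators with these leading terms (`LinearSyzygies.exists_next`). The variables
that occur in the next step are those of the colon ideals `(x_s : s ∈ T, s < t) : x_t` modulo the
initial ideal (`nextVars`).
-/

namespace TwoBorel

open MvPolynomial

/-! ### Prefix degrees and the Borel order -/

/-- The degree of the monomial `w` in the variables `x_k` with `k < t`. -/
noncomputable def prefixDegree {n : ℕ} (t : ℕ) : (Fin n →₀ ℕ) →+ ℕ :=
  ∑ k ∈ Finset.univ.filter (fun k : Fin n => (k : ℕ) < t), Finsupp.applyAddHom k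

section Prefix

variable {n : ℕ}

theorem prefixDegree_apply (t : ℕ) (w : Fin n →₀ ℕ) :
    prefixDegree t w = ∑ k ∈ Finset.univ.filter (fun k : Fin n => (k : ℕ) < t), w k := by
  simp [prefixDegree]

@[simp] theorem prefixDegree_zero (w : Fin n →₀ ℕ) : prefixDegree 0 w = 0 := by
  simp [prefixDegree_apply]

theorem prefixDegree_succ (w : Fin n →₀ ℕ) (k : Fin n) :
    prefixDegree (k + 1) w = prefixDegree k w + w k := by
  have h : (Finset.univ.filter fun l : Fin n => (l : ℕ) < k + 1) =
      insert k (Finset.univ.filter fun l : Fin n => (l : ℕ) < k) := by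
    ext l
    simp only [Finset.mem_filter, Finset.mem_univ, true_and, Finset.mem_insert, Fin.ext_iff]
    omega
  rw [prefixDegree_apply, prefixDegree_apply, h, Finset.sum_insert (by simp), add_comm]

theorem prefixDegree_eq_degree {t : ℕ} (ht : n ≤ t) (w : Fin n →₀ ℕ) :
    prefixDegree t w = w.degree := by
  rw [prefixDegree_apply, Finsupp.degree_eq_sum, Finset.filter_true_of_mem]
  exact fun k _ => k.2.trans_le ht

theorem prefixDegree_mono (w : Fin n →₀ ℕ) {s t : ℕ} (h : s ≤ t) :
    prefixDegree s w ≤ prefixDegree t w := by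
  rw [prefixDegree_apply, prefixDegree_apply]
  refine Finset.sum_le_sum_of_subset fun k hk => ?_
  simp only [Finset.mem_filter, Finset.mem_univ, true_and] at hk ⊢
  omega

theorem prefixDegree_le_degree (t : ℕ) (w : Fin n →₀ ℕ) : prefixDegree t w ≤ w.degree :=
  (prefixDegree_mono w (le_max_left t n)).trans_eq (prefixDegree_eq_degree (le_max_right t n) w)

theorem prefixDegree_single (t : ℕ) (k : Fin n) :
    prefixDegree t (Finsupp.single k 1) = if (k : ℕ) < t then 1 else 0 := by
  simp [prefixDegree_apply, Finsupp.single_apply]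

theorem prefixDegree_injective {v w : Fin n →₀ ℕ}
    (h : ∀ t, prefixDegree t v = prefixDegree t w) : v = w := by
  ext k
  have h1 := h (k + 1)
  rw [prefixDegree_succ, prefixDegree_succ, h k] at h1
  omega

theorem prefixDegree_eq_of_forall_eq_zero (w : Fin n →₀ ℕ) {s t : ℕ} (hst : s ≤ t)
    (h : ∀ k : Fin n, s ≤ k → (k : ℕ) < t → w k = 0) : prefixDegree t w = prefixDegree s w := by
  rw [prefixDegree_apply, prefixDegree_apply]
  refine (Finset.sum_subset (fun k hk => ?_) fun k hk hk' => ?_).symm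
  · simp only [Finset.mem_filter, Finset.mem_univ, true_and] at hk ⊢
    omega
  · simp only [Finset.mem_filter, Finset.mem_univ, true_and] at hk hk'
    exact h k (by omega) hk

/-- If `w` has a variable among the first `t`, the prefix degree is constant from just after the
last such variable up to `t`. -/
theorem exists_last_variable (w : Fin n →₀ ℕ) {t : ℕ} (ht : prefixDegree t w ≠ 0) :
    ∃ i : Fin n, (i : ℕ) < t ∧ w i ≠ 0 ∧
      ∀ s, (i : ℕ) < s → s ≤ t → prefixDegree s w = prefixDegree t w := by
  have hne : (Finset.univ.filter fun k : Fin n => (k : ℕ) < t ∧ w k ≠ 0).Nonempty := by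
    by_contra hcon
    apply ht
    rw [prefixDegree_apply]
    refine Finset.sum_eq_zero fun k hk => ?_
    by_contra h0
    exact hcon ⟨k, by simpa [h0] using hk⟩
  obtain ⟨i, hi, hmax⟩ := Finset.exists_max_image _ (fun k : Fin n => k) hne
  simp only [Finset.mem_filter, Finset.mem_univ, true_and] at hi hmax
  refine ⟨i, hi.1, hi.2, fun s hs hst => ?_⟩
  refine (prefixDegree_eq_of_forall_eq_zero w hst fun k hk hkt => ?_).symm
  by_contra h0
  have := Fin.le_def.1 (hmax k ⟨hkt, h0⟩)
  omega

theorem IsBorelMove.prefixDegree_add {i j : Fin n} {m m' : Fin n →₀ ℕ} (h : IsBorelMove i j m m')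
    (t : ℕ) : prefixDegree t m' + (if (j : ℕ) < t then 1 else 0) =
      prefixDegree t m + (if (i : ℕ) < t then 1 else 0) := by
  have := congrArg (prefixDegree t) h.2
  simpa only [map_add, prefixDegree_single] using this

/-- The Borel order: `m` dominates `b` if `m` has at least the degree of `b` in the first `t`
variables, for every `t`. A monomial dominates `b` exactly if it lies in `Borel(b)`. -/
def BorelLE (b m : Fin n →₀ ℕ) : Prop :=
  ∀ t, prefixDegree t b ≤ prefixDegree t m

theorem BorelLE.degree_le {b m : Fin n →₀ ℕ} (h : BorelLE b m) : b.degree ≤ m.degree := by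
  simpa only [prefixDegree_eq_degree le_rfl] using h n

theorem BorelLE.borelMove {i j : Fin n} {b m m' : Fin n →₀ ℕ} (h : BorelLE b m)
    (hm : IsBorelMove i j m m') : BorelLE b m' := by
  intro t
  have h1 := hm.prefixDegree_add t
  have h2 := h t
  have h3 := Fin.lt_def.1 hm.1
  split_ifs at h1 <;> omega

theorem IsBorelMove.degree_eq {i j : Fin n} {m m' : Fin n →₀ ℕ} (h : IsBorelMove i j m m') :
    m'.degree = m.degree := by
  have := congrArg Finsupp.degree h.2
  simpa using this

theorem exists_isBorelMove {i j : Fin n} (hij : i < j) {m : Fin n →₀ ℕ} (hj : m j ≠ 0) :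
    ∃ m', IsBorelMove i j m m' := by
  refine ⟨m - Finsupp.single j 1 + Finsupp.single i 1, hij, ?_⟩
  rw [add_right_comm, tsub_add_cancel_of_le]
  simpa [Finsupp.single_le_iff] using Nat.one_le_iff_ne_zero.2 hj

theorem exists_isBorelMove_reverse {i j : Fin n} (hij : i < j) {m : Fin n →₀ ℕ} (hi : m i ≠ 0) :
    ∃ m', IsBorelMove i j m' m := by
  refine ⟨m - Finsupp.single i 1 + Finsupp.single j 1, hij, ?_⟩
  rw [add_right_comm, tsub_add_cancel_of_le]
  simpa [Finsupp.single_le_iff] using Nat.one_le_iff_ne_zero.2 hi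

/-- A monomial of larger degree than `b` in `Borel(b)` remains there after dividing it by its last
variable. -/
theorem BorelLE.exists_lt {b m : Fin n →₀ ℕ} (h : BorelLE b m) (hlt : b.degree < m.degree) :
    ∃ m', m' < m ∧ m'.degree + 1 = m.degree ∧ BorelLE b m' := by
  obtain ⟨j, -, hj, hlast⟩ := exists_last_variable m (t := n)
    (by rw [prefixDegree_eq_degree le_rfl]; omega)
  have hle : Finsupp.single j 1 ≤ m := by
    simpa [Finsupp.single_le_iff] using Nat.one_le_iff_ne_zero.2 hj
  obtain ⟨m', rfl⟩ := le_iff_exists_add'.1 hle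
  refine ⟨m', lt_of_le_of_ne le_self_add ?_, by simp, fun t => ?_⟩
  · intro he
    simpa using congrArg Finsupp.degree he
  · by_cases hjt : (j : ℕ) < t
    · have h1 : prefixDegree t (m' + Finsupp.single j 1) = m'.degree + 1 := by
        rcases le_total t n with htn | htn
        · rw [hlast t hjt htn, prefixDegree_eq_degree le_rfl]
          simp
        · rw [prefixDegree_eq_degree htn]
          simp
      rw [map_add, prefixDegree_single, if_pos hjt] at h1
      have h2 := prefixDegree_le_degree t b
      simp only [map_add, Finsupp.degree_single] at hlt
      omega
    · simpa [prefixDegree_single, hjt] using h t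

/-- If `m ≠ b` dominates `b` and has the same degree, then it dominates some Borel move of `b`. -/
theorem BorelLE.exists_borelMove {b m : Fin n →₀ ℕ} (h : BorelLE b m) (hd : b.degree = m.degree)
    (hne : b ≠ m) : ∃ i j b', IsBorelMove i j b b' ∧ BorelLE b' m := by
  have hex : ∃ t, prefixDegree t b < prefixDegree t m := by
    by_contra! hcon
    exact hne (prefixDegree_injective fun t => le_antisymm (h t) (hcon t))
  -- The interval on which the prefix degree of `b` is raised starts at the first strict inequality
  -- and reaches to the next variable of `b`.
  classical
  set t := Nat.find hex with ht
  have htlt : prefixDegree t b < prefixDegree t m := Nat.find_spec hex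
  have htn : t < n := by
    by_contra hcon
    rw [prefixDegree_eq_degree (not_lt.1 hcon), prefixDegree_eq_degree (not_lt.1 hcon), hd] at htlt
    exact lt_irrefl _ htlt
  have ht0 : t ≠ 0 := fun h0 => by simp [h0] at htlt
  have hjex : ∃ j : ℕ, ∃ hj : j < n, t ≤ j ∧ b ⟨j, hj⟩ ≠ 0 := by
    by_contra! hcon
    have := prefixDegree_eq_of_forall_eq_zero b htn.le fun k hk _ => hcon k k.2 hk
    rw [prefixDegree_eq_degree le_rfl, hd] at this
    have := prefixDegree_le_degree t m
    omega
  obtain ⟨hj, htj, hbj⟩ := Nat.find_spec hjex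
  set j := Nat.find hjex
  have hij : (⟨t - 1, by omega⟩ : Fin n) < ⟨j, hj⟩ := Fin.lt_def.2 (by simp only; omega)
  obtain ⟨b', hb'⟩ := exists_isBorelMove hij hbj
  refine ⟨_, _, b', hb', fun s => ?_⟩
  have h1 := hb'.prefixDegree_add s
  have h2 := h s
  by_cases hs : t ≤ s ∧ s ≤ j
  · have h3 := prefixDegree_eq_of_forall_eq_zero b hs.1 fun k hk hks => by
      by_contra h0
      exact Nat.find_min hjex (m := k) (by omega) ⟨k.2, hk, h0⟩
    have h4 := prefixDegree_mono m hs.1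
    simp only at h1
    split_ifs at h1 <;> omega
  · simp only at h1
    split_ifs at h1 <;> omega

end Prefix

/-! ### Monomials and generators of Borel ideals -/

section BorelIdeal

variable {n : ℕ} {K : Type*} [Field K]

theorem monomial_mem_of_le {σ : Type*} {I : Ideal (MvPolynomial σ K)}
    {a b : σ →₀ ℕ} (hab : a ≤ b) (ha : monomial a (1 : K) ∈ I) :
    monomial b (1 : K) ∈ I := by
  obtain ⟨c, rfl⟩ := le_iff_exists_add'.1 hab
  have : monomial (c + a) (1 : K) = monomial c 1 * monomial a 1 := by simp [monomial_mul]
  rw [this]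
  exact I.mul_mem_left _ ha

theorem IsBorel.monomial_mem {J : Ideal (MvPolynomial (Fin n) K)} (hJ : IsBorel J)
    {b : Fin n →₀ ℕ} {m : Fin n →₀ ℕ} (hb : monomial b (1 : K) ∈ J) (h : BorelLE b m) :
    monomial m (1 : K) ∈ J := by
  obtain ⟨k, hk⟩ : ∃ k, m.degree = b.degree + k := ⟨_, (Nat.add_sub_of_le h.degree_le).symm⟩
  induction k generalizing m with
  | zero =>
    -- Each Borel move of `b` towards `m` lowers the total gap between the prefix degrees.
    obtain ⟨g, hg⟩ : ∃ g, g = ∑ t ∈ Finset.range (n + 1), (prefixDegree t m - prefixDegree t b) :=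
      ⟨_, rfl⟩
    induction g using Nat.strong_induction_on generalizing b with
    | _ g ih =>
      by_cases hbm : b = m
      · exact hbm ▸ hb
      obtain ⟨i, j, b', hb', hle⟩ := h.exists_borelMove (by omega) hbm
      refine ih _ ?_ (hJ.borelMove_mem i j b b' hb' hb) hle (by rw [hb'.degree_eq]; exact hk) rfl
      rw [hg]
      have hmono : ∀ t, prefixDegree t b ≤ prefixDegree t b' :=
        BorelLE.borelMove (fun _ => le_rfl) hb'
      refine Finset.sum_lt_sum (fun t _ => ?_) ⟨j, ?_, ?_⟩
      · have := hmono t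
        omega
      · simp only [Finset.mem_range]
        omega
      · have h1 := hb'.prefixDegree_add j
        have h2 := hle j
        have h3 := Fin.lt_def.1 hb'.1
        rw [if_neg (lt_irrefl _), if_pos h3] at h1
        omega
  | succ k ih =>
    obtain ⟨m', hlt, hdeg, hle⟩ := h.exists_lt (by omega)
    exact monomial_mem_of_le hlt.le (ih hle (by omega))

theorem monomial_mem_borelIdeal_iff (B : Set (Fin n →₀ ℕ)) (m : Fin n →₀ ℕ) :
    monomial m (1 : K) ∈ borelIdeal K B ↔ ∃ b ∈ B, BorelLE b m := by
  constructor
  · intro hm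
    set s : Set (Fin n →₀ ℕ) := {w | ∃ b ∈ B, BorelLE b w} with hs
    have hmem : ∀ w, monomial w (1 : K) ∈
        Ideal.span ((fun m => monomial m (1 : K)) '' s) ↔ w ∈ s := by
      intro w
      rw [mem_ideal_span_monomial_image]
      constructor
      · intro h
        obtain ⟨v, ⟨b, hb, hbv⟩, hvw⟩ := h w (by simp)
        refine ⟨b, hb, fun t => (hbv t).trans ?_⟩
        obtain ⟨c, rfl⟩ := le_iff_exists_add.1 hvw
        simp
      · intro h e he
        obtain rfl : e = w := by simpa using support_monomial_subset he
        exact ⟨e, h, le_rfl⟩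
    refine (hmem m).1 (Submodule.mem_sInf.1 hm _ ⟨⟨⟨s, rfl⟩, ?_⟩, ?_⟩)
    · intro i j m m' hmove h
      obtain ⟨b, hb, hbm⟩ := (hmem m).1 h
      exact (hmem m').2 ⟨b, hb, hbm.borelMove hmove⟩
    · exact fun b hb => (hmem b).2 ⟨b, hb, fun _ => le_rfl⟩
  · rintro ⟨b, hb, hbm⟩
    refine (isBorel_borelIdeal K B).monomial_mem ?_ hbm
    exact Submodule.mem_sInf.2 fun J hJ => hJ.2 b hb

/-- The minimal generators of an equigenerated Borel ideal are its monomials of least degree. -/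
theorem mem_gens_borelIdeal_iff {B : Set (Fin n →₀ ℕ)} {d : ℕ} (hB : ∀ b ∈ B, b.degree = d)
    (w : Fin n →₀ ℕ) :
    w ∈ gens (borelIdeal K B) ↔ w.degree = d ∧ ∃ b ∈ B, BorelLE b w := by
  simp only [gens, Set.mem_ofPred_eq, Minimal, monomial_mem_borelIdeal_iff]
  constructor
  · rintro ⟨⟨b, hb, hbw⟩, hmin⟩
    refine ⟨?_, b, hb, hbw⟩
    by_contra hne
    have hlt : b.degree < w.degree := lt_of_le_of_ne hbw.degree_le
      (by rw [hB b hb]; exact Ne.symm hne)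
    obtain ⟨w', hw', -, hle⟩ := hbw.exists_lt hlt
    exact absurd (hmin ⟨b, hb, hle⟩ hw'.le) (not_le_of_gt hw')
  · rintro ⟨hd, hw⟩
    refine ⟨hw, ?_⟩
    rintro v ⟨b, hb, hbv⟩ hvw
    obtain ⟨c, rfl⟩ := le_iff_exists_add.1 hvw
    have h1 := hbv.degree_le
    rw [hB b hb] at h1
    have hc : c.degree = 0 := by
      rw [map_add] at hd
      omega
    rw [Finsupp.degree_eq_zero_iff] at hc
    simp [hc]

end BorelIdeal

/-! ### Multidegrees of monomials of the toric source -/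

section Multidegree

variable {n : ℕ}

/-- The multidegree of a monomial in variables `Y_w` indexed by monomials `w`: its image under
`Y_w ↦ w`. -/
noncomputable def multidegree {s : Set (Fin n →₀ ℕ)} : (s →₀ ℕ) →+ (Fin n →₀ ℕ) :=
  Finsupp.weight (Subtype.val : s → Fin n →₀ ℕ)

variable {s : Set (Fin n →₀ ℕ)}

@[simp] theorem multidegree_single (w : s) :
    multidegree (Finsupp.single w 1) = (w : Fin n →₀ ℕ) := by
  simp [multidegree, Finsupp.weight_single]

theorem map_multidegree (f : (Fin n →₀ ℕ) →+ ℕ) (Z : s →₀ ℕ) :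
    f (multidegree Z) = ∑ w ∈ Z.support, Z w * f w := by
  simp [multidegree, Finsupp.weight_apply, Finsupp.sum]

theorem le_map_multidegree (f : (Fin n →₀ ℕ) →+ ℕ) {Z : s →₀ ℕ} {p : ℕ}
    (h : ∀ w, Z w ≠ 0 → p ≤ f w) : Z.degree * p ≤ f (multidegree Z) := by
  rw [map_multidegree, Finsupp.degree_apply, Finset.sum_mul]
  exact Finset.sum_le_sum fun w hw => Nat.mul_le_mul_left _ (h w (Finsupp.mem_support_iff.1 hw))

theorem map_multidegree_eq (f : (Fin n →₀ ℕ) →+ ℕ) {Z : s →₀ ℕ} {p : ℕ}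
    (h : ∀ w, Z w ≠ 0 → f w = p) : f (multidegree Z) = Z.degree * p := by
  rw [map_multidegree, Finsupp.degree_apply, Finset.sum_mul]
  exact Finset.sum_congr rfl fun w hw => by rw [h w (Finsupp.mem_support_iff.1 hw)]

theorem exists_apply_ne_zero_of_multidegree_apply_ne_zero {Z : s →₀ ℕ} {k : Fin n}
    (h : multidegree Z k ≠ 0) :
    ∃ w, Z w ≠ 0 ∧ (w : Fin n →₀ ℕ) k ≠ 0 := by
  by_contra! hcon
  apply h
  have := map_multidegree (Finsupp.applyAddHom k) Z
  simp only [Finsupp.applyAddHom_apply] at this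
  rw [this]
  exact Finset.sum_eq_zero fun w hw => by rw [hcon w (Finsupp.mem_support_iff.1 hw), mul_zero]

theorem exists_eq_add_single {σ : Type*} {Z : σ →₀ ℕ} {w : σ} (h : Z w ≠ 0) :
    ∃ R, Z = R + Finsupp.single w 1 :=
  le_iff_exists_add'.1 (by simpa [Finsupp.single_le_iff] using Nat.one_le_iff_ne_zero.2 h)

theorem toricMap_monomial {K : Type*} [Field K] (I : Ideal (MvPolynomial (Fin n) K))
    (Z : gens I →₀ ℕ) (c : K) :
    toricMap I (monomial Z c) = monomial (multidegree Z) c := by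
  rw [toricMap, aeval_monomial, multidegree, Finsupp.weight_apply, Finsupp.prod]
  simp only [monomial_pow, one_pow]
  rw [← monomial_sum_one, MvPolynomial.algebraMap_eq, C_mul_monomial, mul_one]
  rfl

theorem mem_fiber_iff {K : Type*} [Field K] {I : Ideal (MvPolynomial (Fin n) K)}
    {μ : Fin n →₀ ℕ} {Z : gens I →₀ ℕ} : Z ∈ fiber I μ ↔ multidegree Z = μ := by
  rw [fiber, Set.mem_ofPred_eq, toricMap_monomial, monomial_left_inj one_ne_zero]

end Multidegree

/-! ### Comparing monomials in the fiber sink order -/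

/-- A monomial with a variable that comes after all variables of `Z` is smaller than `Z`. -/
theorem degRevLex_lt_of_forall_lt {σ : Type*} [LinearOrder σ] [Finite σ] {Z Z' : σ →₀ ℕ}
    (hdeg : Z'.degree = Z.degree) {w : σ} (hw : Z' w ≠ 0) (h : ∀ v, Z v ≠ 0 → v < w) :
    (degRevLex σ).toSyn Z' < (degRevLex σ).toSyn Z := by
  obtain ⟨i, hi, hmax⟩ := Finset.exists_max_image Z'.support id ⟨w, by simpa using hw⟩
  simp only [Finsupp.mem_support_iff, id] at hi hmax
  have hZ : ∀ j, i ≤ j → Z j = 0 := fun j hj => by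
    by_contra h0
    exact absurd ((hmax w hw).trans hj) (not_le_of_gt (h j h0))
  refine (degRevLex_lt_iff _ _).2 (Or.inr ⟨hdeg, i, fun j hj => ?_, ?_⟩)
  · rw [hZ j hj.le]
    by_contra h0
    exact absurd (hmax j h0) (not_le_of_gt hj)
  · rw [hZ i le_rfl]
    exact Nat.pos_of_ne_zero hi

theorem IsBorelMove.toLex_lt {n : ℕ} {i j : Fin n} {m m' : Fin n →₀ ℕ} (h : IsBorelMove i j m m') :
    toLex m < toLex m' := by
  refine Finsupp.Lex.lt_iff.2 ⟨i, fun k hk => ?_, ?_⟩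
  · have h1 := DFunLike.congr_fun h.2 k
    have h2 : j ≠ k := (hk.trans h.1).ne'
    have h3 : i ≠ k := hk.ne'
    simpa [Finsupp.single_apply, h2, h3] using h1.symm
  · have h1 := DFunLike.congr_fun h.2 i
    have h2 : j ≠ i := h.1.ne'
    simp [h2] at h1
    simp [h1]

section Key

variable {n : ℕ} (K : Type*) [Field K] {M N : Fin n →₀ ℕ}

theorem mem_gens_singleton_iff {w : Fin n →₀ ℕ} (hw : w.degree = M.degree) :
    w ∈ gens (borelIdeal K {M}) ↔ BorelLE M w := by
  rw [mem_gens_borelIdeal_iff (d := M.degree) (by simp)]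
  simp [hw]

theorem mem_gens_pair_iff (hdeg : M.degree = N.degree) (w : Fin n →₀ ℕ) :
    w ∈ gens (borelIdeal K {M, N}) ↔ w.degree = M.degree ∧ (BorelLE M w ∨ BorelLE N w) := by
  rw [mem_gens_borelIdeal_iff (d := M.degree) (by simp [hdeg])]
  simp

theorem fiberSinkKey_lt_of_not_of {w w' : Fin n →₀ ℕ} (hw : w.degree = M.degree)
    (hw' : w'.degree = M.degree) (h : ¬ BorelLE M w) (h' : BorelLE M w') :
    fiberSinkKey K M w < fiberSinkKey K M w' := by
  rw [← mem_gens_singleton_iff K hw] at h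
  rw [← mem_gens_singleton_iff K hw'] at h'
  rw [fiberSinkKey, fiberSinkKey, if_neg h, if_pos h']
  exact Sum.Lex.inl_lt_inr _ _

theorem fiberSinkKey_lt_of_of {w w' : Fin n →₀ ℕ} (hw : w.degree = M.degree)
    (hw' : w'.degree = M.degree) (h : BorelLE M w) (h' : BorelLE M w') (hlt : toLex w' < toLex w) :
    fiberSinkKey K M w < fiberSinkKey K M w' := by
  rw [← mem_gens_singleton_iff K hw] at h
  rw [← mem_gens_singleton_iff K hw'] at h'
  rw [fiberSinkKey, fiberSinkKey, if_pos h, if_pos h', Sum.Lex.toLex_lt_toLex, Sum.lex_inr_inr]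
  exact hlt

theorem fiberSinkKey_lt_of_not {w w' : Fin n →₀ ℕ} (hw : w.degree = M.degree)
    (hw' : w'.degree = M.degree) (h : ¬ BorelLE M w) (hlt : toLex w < toLex w') :
    fiberSinkKey K M w < fiberSinkKey K M w' := by
  by_cases h' : BorelLE M w'
  · exact fiberSinkKey_lt_of_not_of K hw hw' h h'
  rw [← mem_gens_singleton_iff K hw] at h
  rw [← mem_gens_singleton_iff K hw'] at h'
  rw [fiberSinkKey, fiberSinkKey, if_neg h, if_neg h', Sum.Lex.toLex_lt_toLex, Sum.lex_inl_inl]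
  exact hlt

theorem fiberSinkOrder_lt_of_forall_lt {Z Z' : gens (borelIdeal K {M, N}) →₀ ℕ}
    (hdeg : Z'.degree = Z.degree) {w : gens (borelIdeal K {M, N})} (hw : Z' w ≠ 0)
    (h : ∀ v, Z v ≠ 0 → fiberSinkKey K M v < fiberSinkKey K M w) :
    (fiberSinkOrder K M N).toSyn Z' < (fiberSinkOrder K M N).toSyn Z :=
  @degRevLex_lt_of_forall_lt _ (fiberSinkVarOrder K M N) _ Z Z' hdeg w hw h

end Key

/-! ### Reduced monomials -/

section Reduced

variable {n : ℕ} {K : Type*} [Field K]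

/-- `Z'` arises from `Z` by a Borel move on one factor and the corresponding reverse Borel move on
another factor. -/
def FiberMove {I : Ideal (MvPolynomial (Fin n) K)} (Z Z' : gens I →₀ ℕ) : Prop :=
  ∃ (i j : Fin n) (Q : gens I →₀ ℕ) (w₁ w₂ w₁' w₂' : gens I),
    Z = Q + Finsupp.single w₁ 1 + Finsupp.single w₂ 1 ∧
    Z' = Q + Finsupp.single w₁' 1 + Finsupp.single w₂' 1 ∧
    IsBorelMove i j (w₁ : Fin n →₀ ℕ) w₁' ∧ IsBorelMove i j (w₂' : Fin n →₀ ℕ) w₂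

section

variable {I : Ideal (MvPolynomial (Fin n) K)}

theorem FiberMove.symm {Z Z' : gens I →₀ ℕ} (h : FiberMove Z Z') : FiberMove Z' Z := by
  obtain ⟨i, j, Q, w₁, w₂, w₁', w₂', h1, h2, h3, h4⟩ := h
  refine ⟨i, j, Q, w₂', w₁', w₂, w₁, ?_, ?_, h4, h3⟩
  · rw [h2, add_right_comm]
  · rw [h1, add_right_comm]

theorem FiberMove.add_right {Z Z' : gens I →₀ ℕ} (h : FiberMove Z Z') (c : gens I →₀ ℕ) :
    FiberMove (Z + c) (Z' + c) := by
  obtain ⟨i, j, Q, w₁, w₂, w₁', w₂', rfl, rfl, h3, h4⟩ := h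
  refine ⟨i, j, Q + c, w₁, w₂, w₁', w₂', ?_, ?_, h3, h4⟩ <;> abel

/-- The two moves of a fiber move cancel in the product of the two factors. -/
theorem IsBorelMove.add_eq_add {i j : Fin n} {w₁ w₂ w₁' w₂' : Fin n →₀ ℕ}
    (h : IsBorelMove i j w₁ w₁') (h' : IsBorelMove i j w₂' w₂) : w₁' + w₂' = w₁ + w₂ := by
  ext k
  have h1 := DFunLike.congr_fun h.2 k
  have h2 := DFunLike.congr_fun h'.2 k
  simp only [Finsupp.add_apply] at h1 h2 ⊢
  omega

theorem FiberMove.multidegree_eq {Z Z' : gens I →₀ ℕ} (h : FiberMove Z Z') :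
    multidegree Z' = multidegree Z := by
  obtain ⟨i, j, Q, w₁, w₂, w₁', w₂', rfl, rfl, h3, h4⟩ := h
  simp only [map_add, multidegree_single, add_assoc, h3.add_eq_add h4]

/-- A monomial is reduced if no fiber move makes it smaller. The reduced monomials of a fiber are
the sinks of its directed fiber graph. -/
def IsReduced (ord : MonomialOrder (gens I)) (Z : gens I →₀ ℕ) : Prop :=
  ∀ Z', FiberMove Z Z' → ¬ ord.toSyn Z' < ord.toSyn Z

theorem IsReduced.of_add {ord : MonomialOrder (gens I)} {Z c : gens I →₀ ℕ}
    (h : IsReduced ord (Z + c)) : IsReduced ord Z := by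
  intro Z' hZ' hlt
  refine h _ (hZ'.add_right c) ?_
  rw [map_add, map_add]
  exact add_lt_add_left hlt _

theorem isSink_iff_isReduced (ord : MonomialOrder (gens I)) {μ : Fin n →₀ ℕ} (Z : fiber I μ) :
    IsSink (fiberDigraph I ord μ) Z ↔ IsReduced ord (Z : gens I →₀ ℕ) := by
  constructor
  · intro h Z' hZ' hlt
    have hmem : Z' ∈ fiber I μ := by
      rw [mem_fiber_iff, hZ'.multidegree_eq]
      exact mem_fiber_iff.1 Z.2
    refine h ⟨Z', hmem⟩ ⟨?_, hlt⟩
    refine (SimpleGraph.fromRel_adj _ _ _).2 ⟨?_, Or.inl hZ'⟩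
    rintro rfl
    exact lt_irrefl _ hlt
  · rintro h Z' ⟨hadj, hlt⟩
    rcases (SimpleGraph.fromRel_adj _ _ _).1 hadj with ⟨-, hm | hm⟩
    · exact h _ hm hlt
    · exact h _ (FiberMove.symm hm) hlt

end

variable {M N : Fin n →₀ ℕ}

theorem exists_last_factor (M : Fin n →₀ ℕ) {s : Set (Fin n →₀ ℕ)} {Z : s →₀ ℕ} (hZ : Z ≠ 0) :
    ∃ w, Z w ≠ 0 ∧ ∀ v, Z v ≠ 0 → fiberSinkKey K M v ≤ fiberSinkKey K M w := by
  obtain ⟨w, hw, hmax⟩ := Finset.exists_max_image Z.support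
    (fun v => fiberSinkKey K M (v : Fin n →₀ ℕ)) (Finsupp.support_nonempty_iff.2 hZ)
  simp only [Finsupp.mem_support_iff] at hw hmax
  exact ⟨w, hw, hmax⟩

/-- A reverse Borel move stays in `Borel(b)` if no prefix degree affected by it is already as small
as that of `b`. -/
theorem BorelLE.reverse_borelMove {i j : Fin n} {b m m' : Fin n →₀ ℕ} (h : BorelLE b m')
    (hm : IsBorelMove i j m m')
    (hne : ∀ t, (i : ℕ) < t → t ≤ j → prefixDegree t m' ≠ prefixDegree t b) : BorelLE b m := by
  intro t
  have h1 := hm.prefixDegree_add t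
  have h2 := h t
  have h3 := hne t
  have h4 := Fin.lt_def.1 hm.1
  split_ifs at h1 <;> omega

/-- Let the last factor `w` of a reduced monomial lie in `Borel(M)`. A move exchanging `x_i` in `w`
for `x_j` in another factor is blocked by the condition `w ∈ Borel(M)`. -/
theorem IsReduced.exists_prefixDegree_eq_of_borelLE (hdeg : M.degree = N.degree)
    {R : gens (borelIdeal K {M, N}) →₀ ℕ} {w c : gens (borelIdeal K {M, N})}
    (hZ : IsReduced (fiberSinkOrder K M N) (R + Finsupp.single w 1))
    (hlast : ∀ v, R v ≠ 0 → fiberSinkKey K M v ≤ fiberSinkKey K M w)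
    (hw : BorelLE M (w : Fin n →₀ ℕ)) (hc : R c ≠ 0) {i j : Fin n} (hij : i < j)
    (hi : (w : Fin n →₀ ℕ) i ≠ 0) (hj : (c : Fin n →₀ ℕ) j ≠ 0) :
    ∃ t, (i : ℕ) < t ∧ t ≤ j ∧ prefixDegree t (w : Fin n →₀ ℕ) = prefixDegree t M := by
  by_contra! hcon
  obtain ⟨Q, rfl⟩ := exists_eq_add_single hc
  obtain ⟨c', hc'⟩ := exists_isBorelMove hij hj
  obtain ⟨w', hw'⟩ := exists_isBorelMove_reverse hij hi
  have hwd := ((mem_gens_pair_iff K hdeg _).1 w.2).1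
  have hwM : BorelLE M w' := hw.reverse_borelMove hw' hcon
  have hw'd : w'.degree = M.degree := by rw [← hw'.degree_eq, hwd]
  have hw'I : w' ∈ gens (borelIdeal K {M, N}) :=
    (mem_gens_pair_iff K hdeg _).2 ⟨hw'd, Or.inl hwM⟩
  have hc'I : c' ∈ gens (borelIdeal K {M, N}) := by
    have := (mem_gens_pair_iff K hdeg _).1 c.2
    exact (mem_gens_pair_iff K hdeg _).2 ⟨by rw [hc'.degree_eq, this.1],
      this.2.imp (fun h => h.borelMove hc') fun h => h.borelMove hc'⟩
  have hlt := fiberSinkKey_lt_of_of K hwd hw'd hw hwM hw'.toLex_lt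
  refine hZ (Q + Finsupp.single ⟨c', hc'I⟩ 1 + Finsupp.single ⟨w', hw'I⟩ 1)
    ⟨i, j, Q, c, w, ⟨c', hc'I⟩, ⟨w', hw'I⟩, rfl, rfl, hc', hw'⟩ ?_
  refine fiberSinkOrder_lt_of_forall_lt K (w := ⟨w', hw'I⟩) (by simp) (by simp) fun v hv => ?_
  by_cases hvw : v = w
  · exact hvw ▸ hlt
  · refine lt_of_le_of_lt (hlast v ?_) hlt
    simpa [Finsupp.single_apply, Ne.symm hvw] using hv

/-- Let the last factor `w` of a reduced monomial lie outside `Borel(M)`. A move exchanging `x_j` in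
`w` for `x_i` in another factor `c` is blocked by the condition `c ∈ Borel(N)`. -/
theorem IsReduced.exists_prefixDegree_eq_of_not_borelLE (hdeg : M.degree = N.degree)
    {R : gens (borelIdeal K {M, N}) →₀ ℕ} {w c : gens (borelIdeal K {M, N})}
    (hZ : IsReduced (fiberSinkOrder K M N) (R + Finsupp.single w 1))
    (hlast : ∀ v, R v ≠ 0 → fiberSinkKey K M v ≤ fiberSinkKey K M w)
    (hw : ¬ BorelLE M (w : Fin n →₀ ℕ)) (hc : R c ≠ 0) (hcN : BorelLE N (c : Fin n →₀ ℕ))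
    {i j : Fin n} (hij : i < j)
    (hi : (c : Fin n →₀ ℕ) i ≠ 0) (hj : (w : Fin n →₀ ℕ) j ≠ 0) :
    ∃ t, (i : ℕ) < t ∧ t ≤ j ∧ prefixDegree t (c : Fin n →₀ ℕ) = prefixDegree t N := by
  by_contra! hcon
  obtain ⟨Q, rfl⟩ := exists_eq_add_single hc
  obtain ⟨w', hw'⟩ := exists_isBorelMove hij hj
  obtain ⟨c', hc'⟩ := exists_isBorelMove_reverse hij hi
  have hwI := (mem_gens_pair_iff K hdeg _).1 w.2
  have hcI := (mem_gens_pair_iff K hdeg _).1 c.2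
  have hw'd : w'.degree = M.degree := by rw [hw'.degree_eq, hwI.1]
  have hw'I : w' ∈ gens (borelIdeal K {M, N}) :=
    (mem_gens_pair_iff K hdeg _).2 ⟨hw'd,
      hwI.2.imp (fun h => h.borelMove hw') fun h => h.borelMove hw'⟩
  have hc'I : c' ∈ gens (borelIdeal K {M, N}) :=
    (mem_gens_pair_iff K hdeg _).2 ⟨by rw [← hc'.degree_eq, hcI.1],
      Or.inr (hcN.reverse_borelMove hc' hcon)⟩
  have hlt := fiberSinkKey_lt_of_not K hwI.1 hw'd hw hw'.toLex_lt
  refine hZ (Q + Finsupp.single ⟨w', hw'I⟩ 1 + Finsupp.single ⟨c', hc'I⟩ 1)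
    ⟨i, j, Q, w, c, ⟨w', hw'I⟩, ⟨c', hc'I⟩, add_right_comm _ _ _, rfl, hw', hc'⟩ ?_
  refine fiberSinkOrder_lt_of_forall_lt K (w := ⟨w', hw'I⟩) (by simp) (by simp) fun v hv => ?_
  by_cases hvw : v = w
  · exact hvw ▸ hlt
  · refine lt_of_le_of_lt (hlast v ?_) hlt
    simpa [Finsupp.single_apply, Ne.symm hvw] using hv

/-! ### Uniqueness of the reduced monomial of a fiber -/

/-- The last factor of a reduced monomial, if it lies in `Borel(M)`, is the least element in the
Borel order among the divisors of the multidegree in `Borel(M)`. -/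
theorem IsReduced.borelLE_of_borelLE (hdeg : M.degree = N.degree)
    {R : gens (borelIdeal K {M, N}) →₀ ℕ} {w : gens (borelIdeal K {M, N})}
    (hZ : IsReduced (fiberSinkOrder K M N) (R + Finsupp.single w 1))
    (hlast : ∀ v, R v ≠ 0 → fiberSinkKey K M v ≤ fiberSinkKey K M w)
    (hw : BorelLE M (w : Fin n →₀ ℕ)) {c : Fin n →₀ ℕ} (hc : BorelLE M c)
    (hcle : c ≤ multidegree (R + Finsupp.single w 1)) (hcd : c.degree = M.degree) :
    BorelLE (w : Fin n →₀ ℕ) c := by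
  have hwd := ((mem_gens_pair_iff K hdeg _).1 w.2).1
  intro t
  induction t with
  | zero => simp
  | succ t ih =>
    rcases le_or_gt n t with htn | htn
    · rw [prefixDegree_eq_degree (by omega), prefixDegree_eq_degree (by omega), hwd, hcd]
    by_cases hwt : (w : Fin n →₀ ℕ) ⟨t, htn⟩ = 0
    · have h1 := prefixDegree_succ (w : Fin n →₀ ℕ) ⟨t, htn⟩
      have h2 := prefixDegree_mono c (Nat.le_add_right t 1)
      simp only at h1
      omega
    -- Beyond `x_t`, up to the next prefix degree at which `w` agrees with `M`, the multidegree
    -- has no variables other than those of `w`.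
    have hex : ∃ s, t < s ∧ prefixDegree s (w : Fin n →₀ ℕ) = prefixDegree s M :=
      ⟨n, htn, by rw [prefixDegree_eq_degree le_rfl, prefixDegree_eq_degree le_rfl, hwd]⟩
    classical
    obtain ⟨hts, hs⟩ := Nat.find_spec hex
    set s := Nat.find hex
    have hR : prefixDegree s (multidegree R) = prefixDegree (t + 1) (multidegree R) := by
      refine prefixDegree_eq_of_forall_eq_zero _ hts fun k hk hks => ?_
      by_contra h0
      obtain ⟨v, hv, hvk⟩ := exists_apply_ne_zero_of_multidegree_apply_ne_zero h0
      obtain ⟨t', ht', ht'k, heq⟩ := hZ.exists_prefixDegree_eq_of_borelLE hdeg hlast hw hv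
        (i := ⟨t, htn⟩) (j := k) (Fin.lt_def.2 hk) hwt hvk
      exact Nat.find_min hex (m := t') (by omega) ⟨ht', heq⟩
    obtain ⟨e, he⟩ := le_iff_exists_add.1 hcle
    have hc1 := congrArg (prefixDegree s) he
    have hc2 := congrArg (prefixDegree (t + 1)) he
    simp only [map_add, multidegree_single] at hc1 hc2
    have he' := prefixDegree_mono e (show t + 1 ≤ s from hts)
    have hcM := hc s
    omega

/-- Let the last factor `w` of a reduced monomial lie outside `Borel(M)`. For every variable `x_j` of
`w`, the other factors have the smallest possible degree in the variables before `x_j`. -/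
theorem IsReduced.prefixDegree_multidegree_eq (hdeg : M.degree = N.degree)
    {R : gens (borelIdeal K {M, N}) →₀ ℕ} {w : gens (borelIdeal K {M, N})}
    (hZ : IsReduced (fiberSinkOrder K M N) (R + Finsupp.single w 1))
    (hlast : ∀ v, R v ≠ 0 → fiberSinkKey K M v ≤ fiberSinkKey K M w)
    (hw : ¬ BorelLE M (w : Fin n →₀ ℕ)) {j : Fin n} (hj : (w : Fin n →₀ ℕ) j ≠ 0) :
    prefixDegree j (multidegree R) = R.degree * prefixDegree j N := by
  refine map_multidegree_eq _ fun c hc => ?_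
  have hcI := (mem_gens_pair_iff K hdeg _).1 c.2
  have hcM : ¬ BorelLE M (c : Fin n →₀ ℕ) := fun h => absurd (hlast c hc) (not_le_of_gt
    (fiberSinkKey_lt_of_not_of K ((mem_gens_pair_iff K hdeg _).1 w.2).1 hcI.1 hw h))
  have hcN := hcI.2.resolve_left hcM
  by_cases h0 : prefixDegree j (c : Fin n →₀ ℕ) = 0
  · have := hcN j
    omega
  obtain ⟨i, hij, hi, hconst⟩ := exists_last_variable _ h0
  obtain ⟨t, hit, htj, ht⟩ := hZ.exists_prefixDegree_eq_of_not_borelLE hdeg hlast hw hc hcN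
    (Fin.lt_def.2 hij) hi hj
  have h1 := hconst t hit htj
  have h2 := hcN j
  have h3 := prefixDegree_mono N htj
  omega

/-- If the last factor of a reduced monomial lies outside `Borel(M)`, then no factor of a monomial of
the same multidegree lies in `Borel(M)`. -/
theorem IsReduced.not_borelLE (hdeg : M.degree = N.degree)
    {R R' : gens (borelIdeal K {M, N}) →₀ ℕ} {w w' : gens (borelIdeal K {M, N})}
    (hZ : IsReduced (fiberSinkOrder K M N) (R + Finsupp.single w 1))
    (hlast : ∀ v, R v ≠ 0 → fiberSinkKey K M v ≤ fiberSinkKey K M w)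
    (hw : ¬ BorelLE M (w : Fin n →₀ ℕ))
    (hmul : multidegree (R + Finsupp.single w 1) = multidegree (R' + Finsupp.single w' 1))
    (hd : R.degree = R'.degree) : ¬ BorelLE M (w' : Fin n →₀ ℕ) := by
  intro hw'
  have hwI := (mem_gens_pair_iff K hdeg _).1 w.2
  have hwN := hwI.2.resolve_left hw
  -- Take the last prefix degree in which `w` falls short of `M`.
  have hne : ((Finset.range n).filter fun t =>
      prefixDegree t (w : Fin n →₀ ℕ) < prefixDegree t M).Nonempty := by
    unfold BorelLE at hw
    push Not at hw
    obtain ⟨t, ht⟩ := hw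
    refine ⟨t, ?_⟩
    simp only [Finset.mem_filter, Finset.mem_range]
    refine ⟨?_, ht⟩
    by_contra hcon
    rw [prefixDegree_eq_degree (by omega), prefixDegree_eq_degree (by omega), hwI.1] at ht
    exact lt_irrefl _ ht
  obtain ⟨t, ht, hmax⟩ := Finset.exists_max_image _ id hne
  simp only [Finset.mem_filter, Finset.mem_range, id] at ht hmax
  obtain ⟨htn, ht⟩ := ht
  have hsucc : prefixDegree (t + 1) M ≤ prefixDegree (t + 1) (w : Fin n →₀ ℕ) := by
    by_contra hcon
    push Not at hcon
    rcases Nat.lt_or_ge (t + 1) n with h | h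
    · have := hmax (t + 1) ⟨h, hcon⟩
      omega
    · rw [prefixDegree_eq_degree h, prefixDegree_eq_degree h, hwI.1] at hcon
      exact lt_irrefl _ hcon
  have hj : (w : Fin n →₀ ℕ) ⟨t, htn⟩ ≠ 0 := by
    have h1 := prefixDegree_succ (w : Fin n →₀ ℕ) ⟨t, htn⟩
    have h2 := prefixDegree_mono M (Nat.le_add_right t 1)
    simp only at h1
    omega
  have h1 : prefixDegree t (multidegree R) = R.degree * prefixDegree t N :=
    hZ.prefixDegree_multidegree_eq hdeg hlast hw hj
  have h2 : R'.degree * prefixDegree t N ≤ prefixDegree t (multidegree R') := by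
    refine le_map_multidegree _ fun v _ => ?_
    rcases ((mem_gens_pair_iff K hdeg _).1 v.2).2 with h | h
    · have := h t
      have := hwN t
      omega
    · exact h t
  have h3 := congrArg (prefixDegree t) hmul
  simp only [map_add, multidegree_single] at h3
  have h4 := hw' t
  rw [hd] at h1
  omega

/-- If the factors of two monomials of the same multidegree and degree lie outside `Borel(M)` and the
first monomial is reduced, its last factor dominates the factors of the second one. -/
theorem IsReduced.borelLE_of_not_borelLE (hdeg : M.degree = N.degree)
    {R R' : gens (borelIdeal K {M, N}) →₀ ℕ} {w w' : gens (borelIdeal K {M, N})}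
    (hZ : IsReduced (fiberSinkOrder K M N) (R + Finsupp.single w 1))
    (hlast : ∀ v, R v ≠ 0 → fiberSinkKey K M v ≤ fiberSinkKey K M w)
    (hw : ¬ BorelLE M (w : Fin n →₀ ℕ))
    (hmul : multidegree (R + Finsupp.single w 1) = multidegree (R' + Finsupp.single w' 1))
    (hd : R.degree = R'.degree) (hR' : ∀ v, R' v ≠ 0 → BorelLE N (v : Fin n →₀ ℕ)) :
    BorelLE (w' : Fin n →₀ ℕ) w := by
  have hwd := ((mem_gens_pair_iff K hdeg _).1 w.2).1
  have hwd' := ((mem_gens_pair_iff K hdeg _).1 w'.2).1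
  have hlarge : ∀ t, n ≤ t →
      prefixDegree t (w' : Fin n →₀ ℕ) ≤ prefixDegree t (w : Fin n →₀ ℕ) := fun t ht => by
    rw [prefixDegree_eq_degree ht, prefixDegree_eq_degree ht, hwd, hwd']
  intro t
  rcases le_total n t with htn | htn
  · exact hlarge t htn
  induction htn using Nat.decreasingInduction with
  | self => exact hlarge n le_rfl
  | of_succ t htn ih =>
    by_cases hwt : (w : Fin n →₀ ℕ) ⟨t, htn⟩ = 0
    · have h1 := prefixDegree_succ (w : Fin n →₀ ℕ) ⟨t, htn⟩
      have h2 := prefixDegree_mono (w' : Fin n →₀ ℕ) (Nat.le_add_right t 1)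
      simp only at h1
      omega
    have h1 : prefixDegree t (multidegree R) = R.degree * prefixDegree t N :=
      hZ.prefixDegree_multidegree_eq hdeg hlast hw hwt
    have h2 : R'.degree * prefixDegree t N ≤ prefixDegree t (multidegree R') :=
      le_map_multidegree _ fun v hv => hR' v hv t
    have h3 := congrArg (prefixDegree t) hmul
    simp only [map_add, multidegree_single] at h3
    rw [hd] at h1
    omega

theorem degree_multidegree (hdeg : M.degree = N.degree)
    (Z : gens (borelIdeal K {M, N}) →₀ ℕ) : (multidegree Z).degree = Z.degree * M.degree :=
  map_multidegree_eq _ fun w _ => ((mem_gens_pair_iff K hdeg _).1 w.2).1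

/-- Every fiber contains at most one reduced monomial: the last factors of two reduced monomials
agree, and removing a factor leaves a reduced monomial. -/
theorem IsReduced.eq_of_multidegree_eq (hdeg : M.degree = N.degree) (hpos : 0 < M.degree)
    {Z Z' : gens (borelIdeal K {M, N}) →₀ ℕ} (hZ : IsReduced (fiberSinkOrder K M N) Z)
    (hZ' : IsReduced (fiberSinkOrder K M N) Z') (hmul : multidegree Z = multidegree Z') :
    Z = Z' := by
  have hd : Z.degree = Z'.degree := by
    have := congrArg Finsupp.degree hmul
    rw [degree_multidegree hdeg, degree_multidegree hdeg] at this
    exact Nat.eq_of_mul_eq_mul_right hpos this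
  obtain ⟨k, hk⟩ : ∃ k, k = Z.degree := ⟨_, rfl⟩
  induction k generalizing Z Z' with
  | zero =>
    rw [(Finsupp.degree_eq_zero_iff Z).1 hk.symm, (Finsupp.degree_eq_zero_iff Z').1 (by omega)]
  | succ k ih =>
    have hne : Z ≠ 0 := fun h => by simp [h] at hk
    have hne' : Z' ≠ 0 := fun h => by simp [hd, h] at hk
    obtain ⟨w, hw, hlast⟩ := exists_last_factor (K := K) M hne
    obtain ⟨w', hw', hlast'⟩ := exists_last_factor (K := K) M hne'
    obtain ⟨R, rfl⟩ := exists_eq_add_single hw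
    obtain ⟨R', rfl⟩ := exists_eq_add_single hw'
    have hl : ∀ v, R v ≠ 0 → fiberSinkKey K M v ≤ fiberSinkKey K M w :=
      fun v hv => hlast v (by simp [hv])
    have hl' : ∀ v, R' v ≠ 0 → fiberSinkKey K M v ≤ fiberSinkKey K M w' :=
      fun v hv => hlast' v (by simp [hv])
    have hRd : R.degree = R'.degree := by simpa using hd
    have hwI := (mem_gens_pair_iff K hdeg _).1 w.2
    have hwI' := (mem_gens_pair_iff K hdeg _).1 w'.2
    have hle : ∀ {S : gens (borelIdeal K {M, N}) →₀ ℕ} {v : gens (borelIdeal K {M, N})},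
        (v : Fin n →₀ ℕ) ≤ multidegree (S + Finsupp.single v 1) := fun {S v} => by
      rw [map_add, multidegree_single]
      exact le_add_self
    have hBorelN : ∀ {S : gens (borelIdeal K {M, N}) →₀ ℕ} {v : gens (borelIdeal K {M, N})},
        (∀ u, S u ≠ 0 → fiberSinkKey K M u ≤ fiberSinkKey K M v) →
        ¬ BorelLE M (v : Fin n →₀ ℕ) → ∀ u, S u ≠ 0 → BorelLE N (u : Fin n →₀ ℕ) := by
      intro S v hS hv u hu
      have huI := (mem_gens_pair_iff K hdeg _).1 u.2
      refine huI.2.resolve_left fun h => absurd (hS u hu) (not_le_of_gt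
        (fiberSinkKey_lt_of_not_of K ((mem_gens_pair_iff K hdeg _).1 v.2).1 huI.1 hv h))
    have heq : w = w' := by
      suffices h : BorelLE (w : Fin n →₀ ℕ) w' ∧ BorelLE (w' : Fin n →₀ ℕ) w from
        Subtype.ext (prefixDegree_injective fun t => le_antisymm (h.1 t) (h.2 t))
      by_cases hM : BorelLE M (w : Fin n →₀ ℕ)
      · have hM' : BorelLE M (w' : Fin n →₀ ℕ) := by
          by_contra h
          exact hZ'.not_borelLE hdeg hl' h hmul.symm hRd.symm hM
        exact ⟨hZ.borelLE_of_borelLE hdeg hl hM hM' (hmul ▸ hle) hwI'.1,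
          hZ'.borelLE_of_borelLE hdeg hl' hM' hM (hmul ▸ hle) hwI.1⟩
      · have hM' := hZ.not_borelLE hdeg hl hM hmul hRd
        exact ⟨hZ'.borelLE_of_not_borelLE hdeg hl' hM' hmul.symm hRd.symm (hBorelN hl hM),
          hZ.borelLE_of_not_borelLE hdeg hl hM hmul hRd (hBorelN hl' hM')⟩
    subst heq
    rw [map_add, map_add, add_left_inj] at hmul
    rw [ih hZ.of_add hZ'.of_add hmul hRd (by simpa using hk)]

theorem exists_isReduced {I : Ideal (MvPolynomial (Fin n) K)} (ord : MonomialOrder (gens I))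
    (Z : gens I →₀ ℕ) : ∃ Z', multidegree Z' = multidegree Z ∧
      ord.toSyn Z' ≤ ord.toSyn Z ∧ IsReduced ord Z' := by
  induction h : ord.toSyn Z using WellFoundedLT.induction generalizing Z with
  | ind a ih =>
    by_cases hZ : IsReduced ord Z
    · exact ⟨Z, rfl, h.le, hZ⟩
    · unfold IsReduced at hZ
      push Not at hZ
      obtain ⟨Z₁, hmove, hlt⟩ := hZ
      obtain ⟨Z', h1, h2, h3⟩ := ih _ (h ▸ hlt) Z₁ rfl
      exact ⟨Z', h1.trans hmove.multidegree_eq, h2.trans (h ▸ hlt.le), h3⟩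

/-- A reduced monomial is the smallest monomial of its fiber. -/
theorem IsReduced.le_of_multidegree_eq (hdeg : M.degree = N.degree) (hpos : 0 < M.degree)
    {Z Z' : gens (borelIdeal K {M, N}) →₀ ℕ} (hZ : IsReduced (fiberSinkOrder K M N) Z)
    (hmul : multidegree Z = multidegree Z') :
    (fiberSinkOrder K M N).toSyn Z ≤ (fiberSinkOrder K M N).toSyn Z' := by
  obtain ⟨Z'', h1, h2, h3⟩ := exists_isReduced (fiberSinkOrder K M N) Z'
  rwa [hZ.eq_of_multidegree_eq hdeg hpos h3 (hmul.trans h1.symm)]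

theorem existsUnique_isSink (hdeg : M.degree = N.degree) (hpos : 0 < M.degree) {μ : Fin n →₀ ℕ}
    (hμ : (fiber (borelIdeal K {M, N}) μ).Nonempty) :
    ∃! Z : fiber (borelIdeal K {M, N}) μ,
      IsSink (fiberDigraph (borelIdeal K {M, N}) (fiberSinkOrder K M N) μ) Z := by
  obtain ⟨Z₀, h₀⟩ := hμ
  obtain ⟨Z, h1, -, h3⟩ := exists_isReduced (fiberSinkOrder K M N) Z₀
  refine ⟨⟨Z, mem_fiber_iff.2 (h1.trans (mem_fiber_iff.1 h₀))⟩,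
    (isSink_iff_isReduced _ _).2 h3, fun Z' hZ' => Subtype.ext ?_⟩
  exact ((isSink_iff_isReduced _ _).1 hZ').eq_of_multidegree_eq hdeg hpos h3
    ((mem_fiber_iff.1 Z'.2).trans (h1.trans (mem_fiber_iff.1 h₀)).symm)

end Reduced

/-! ### The quadratic Gröbner basis -/

section Groebner

variable {n : ℕ} {K : Type*} [Field K]

theorem coeff_toricMap {I : Ideal (MvPolynomial (Fin n) K)} (f : ToricSource I)
    (μ : Fin n →₀ ℕ) :
    coeff μ (toricMap I f) = ∑ Z ∈ f.support with multidegree Z = μ, coeff Z f := by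
  classical
  conv_lhs => rw [f.as_sum, map_sum, coeff_sum]
  rw [Finset.sum_filter]
  exact Finset.sum_congr rfl fun Z _ => by rw [toricMap_monomial, coeff_monomial]

/-- The coefficients of an element of the toric ideal in any fiber sum to zero, so its monomials do
not lie alone in their fibers. -/
theorem exists_ne_of_mem_toricIdeal {I : Ideal (MvPolynomial (Fin n) K)} {f : ToricSource I}
    (hf : f ∈ toricIdeal I) {Z : gens I →₀ ℕ} (hZ : Z ∈ f.support) :
    ∃ Z' ∈ f.support, Z' ≠ Z ∧ multidegree Z' = multidegree Z := by
  by_contra! hcon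
  have h0 := coeff_toricMap f (multidegree Z)
  rw [(RingHom.mem_ker).1 hf, coeff_zero, Finset.sum_eq_single Z] at h0
  · exact (mem_support_iff.1 hZ) h0.symm
  · intro Z' hZ' hne
    rw [Finset.mem_filter] at hZ'
    exact absurd hZ'.2 (hcon Z' hZ'.1 hne)
  · intro h
    simp only [Finset.mem_filter, and_true] at h
    exact absurd hZ h

variable {M N : Fin n →₀ ℕ}

theorem not_isReduced_degree (hdeg : M.degree = N.degree) (hpos : 0 < M.degree)
    {f : ToricSource (borelIdeal K {M, N})} (hf : f ∈ toricIdeal (borelIdeal K {M, N}))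
    (h0 : f ≠ 0) :
    ¬ IsReduced (fiberSinkOrder K M N) ((fiberSinkOrder K M N).degree f) := by
  intro hred
  obtain ⟨Z, hZ, hne, hmul⟩ := exists_ne_of_mem_toricIdeal hf
    ((fiberSinkOrder K M N).degree_mem_support h0)
  refine hne ((fiberSinkOrder K M N).toSyn.injective (le_antisymm ?_ ?_))
  · exact (fiberSinkOrder K M N).le_degree hZ
  · exact hred.le_of_multidegree_eq hdeg hpos hmul.symm

theorem exists_quadric_of_not_isReduced {I : Ideal (MvPolynomial (Fin n) K)}
    {ord : MonomialOrder (gens I)} {Z : gens I →₀ ℕ} (hZ : ¬ IsReduced ord Z) :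
    ∃ a b : gens I →₀ ℕ, a.degree = 2 ∧ b.degree = 2 ∧ multidegree a = multidegree b ∧
      ord.toSyn b < ord.toSyn a ∧ a ≤ Z := by
  unfold IsReduced at hZ
  push Not at hZ
  obtain ⟨Z', ⟨i, j, Q, w₁, w₂, w₁', w₂', rfl, rfl, h1, h2⟩, hlt⟩ := hZ
  refine ⟨Finsupp.single w₁ 1 + Finsupp.single w₂ 1, Finsupp.single w₁' 1 + Finsupp.single w₂' 1,
    by simp, by simp, ?_, ?_, ?_⟩
  · simp only [map_add, multidegree_single, h1.add_eq_add h2]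
  · simp only [add_assoc, map_add ord.toSyn Q] at hlt
    exact lt_of_add_lt_add_left hlt
  · rw [add_assoc]
    exact le_add_self

/-- The binomials of degree two in the toric ideal. -/
def quadricBinomials (I : Ideal (MvPolynomial (Fin n) K)) : Set (ToricSource I) :=
  {f | ∃ a b : gens I →₀ ℕ, a.degree = 2 ∧ b.degree = 2 ∧ a ≠ b ∧ multidegree a = multidegree b ∧
    f = monomial a 1 - monomial b 1}

theorem quadricBinomials_finite (I : Ideal (MvPolynomial (Fin n) K)) :
    (quadricBinomials I).Finite := by
  have hfin : {a : gens I →₀ ℕ | a.degree ≤ 2}.Finite := Finsupp.finite_of_degree_le 2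
  refine ((hfin.prod hfin).image fun p => monomial p.1 (1 : K) - monomial p.2 1).subset ?_
  rintro _ ⟨a, b, ha, hb, -, -, rfl⟩
  exact ⟨(a, b), ⟨ha.le, hb.le⟩, rfl⟩

theorem monomial_sub_monomial_mem_toricIdeal {I : Ideal (MvPolynomial (Fin n) K)}
    {a b : gens I →₀ ℕ} (h : multidegree a = multidegree b) :
    monomial a 1 - monomial b 1 ∈ toricIdeal I := by
  rw [toricIdeal, RingHom.mem_ker, map_sub, toricMap_monomial, toricMap_monomial, h, sub_self]

theorem degree_monomial_sub_monomial {σ : Type*} (ord : MonomialOrder σ) {a b : σ →₀ ℕ}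
    (h : ord.toSyn b < ord.toSyn a) :
    ord.degree (monomial a (1 : K) - monomial b 1) = a := by
  classical
  rw [MonomialOrder.degree_sub_of_lt]
  · simp [MonomialOrder.degree_monomial]
  · simpa [MonomialOrder.degree_monomial] using h

theorem monomial_sub_monomial_ne_zero {σ : Type*} {a b : σ →₀ ℕ} (h : a ≠ b) :
    monomial a (1 : K) - monomial b 1 ≠ 0 := by
  rw [sub_ne_zero]
  exact fun hab => h ((monomial_left_inj one_ne_zero).1 hab)

/-- The leading monomial of an element of the toric ideal is not reduced, so a fiber move of it
yields a quadric binomial whose leading monomial divides it. -/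
theorem exists_quadricBinomial_degree_le (hdeg : M.degree = N.degree) (hpos : 0 < M.degree)
    {f : ToricSource (borelIdeal K {M, N})} (hf : f ∈ toricIdeal (borelIdeal K {M, N}))
    (h0 : f ≠ 0) :
    ∃ g ∈ quadricBinomials (borelIdeal K {M, N}), g ∈ toricIdeal (borelIdeal K {M, N}) ∧ g ≠ 0 ∧
      (fiberSinkOrder K M N).leadingCoeff g = 1 ∧
      ((fiberSinkOrder K M N).degree g).degree = 2 ∧
      (fiberSinkOrder K M N).degree g ≤ (fiberSinkOrder K M N).degree f := by
  obtain ⟨a, b, ha, hb, hmul, hlt, hle⟩ :=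
    exists_quadric_of_not_isReduced (not_isReduced_degree hdeg hpos hf h0)
  have hab : a ≠ b := by
    rintro rfl
    exact lt_irrefl _ hlt
  have hd : (fiberSinkOrder K M N).degree (monomial a (1 : K) - monomial b 1) = a :=
    degree_monomial_sub_monomial _ hlt
  refine ⟨_, ⟨a, b, ha, hb, hab, hmul, rfl⟩, monomial_sub_monomial_mem_toricIdeal hmul,
    monomial_sub_monomial_ne_zero hab, ?_, ?_, ?_⟩
  · classical
    rw [MonomialOrder.leadingCoeff, hd]
    simp [coeff_monomial, hab.symm]
  · rw [hd, ha]
  · rwa [hd]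

theorem isGroebnerBasis_quadricBinomials (hdeg : M.degree = N.degree) (hpos : 0 < M.degree) :
    IsGroebnerBasis (fiberSinkOrder K M N) (quadricBinomials (borelIdeal K {M, N}))
      (toricIdeal (borelIdeal K {M, N})) := by
  have hsub : quadricBinomials (borelIdeal K {M, N}) ⊆
      (toricIdeal (borelIdeal K {M, N}) : Set (ToricSource (borelIdeal K {M, N}))) := by
    rintro _ ⟨a, b, -, -, -, hmul, rfl⟩
    exact monomial_sub_monomial_mem_toricIdeal hmul
  refine ⟨quadricBinomials_finite _, hsub, le_antisymm (Ideal.span_mono (Set.image_mono hsub)) ?_⟩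
  rw [Ideal.span_le]
  rintro _ ⟨f, hf, rfl⟩
  by_cases h0 : f = 0
  · simp [h0, MonomialOrder.leadingTerm]
  obtain ⟨g, hg, -, -, hlc, -, hle⟩ := exists_quadricBinomial_degree_le hdeg hpos hf h0
  obtain ⟨c, hc⟩ := le_iff_exists_add'.1 hle
  have : (fiberSinkOrder K M N).leadingTerm f =
      monomial c ((fiberSinkOrder K M N).leadingCoeff f) *
        (fiberSinkOrder K M N).leadingTerm g := by
    rw [MonomialOrder.leadingTerm, MonomialOrder.leadingTerm, monomial_mul, hlc, mul_one, hc]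
  rw [SetLike.mem_coe, this]
  exact Ideal.mul_mem_left _ _ (Ideal.subset_span ⟨g, hg, rfl⟩)

end Groebner

/-! ### Leading terms in free modules -/

section FreeModule

variable {σ K : Type*} [Field K] {ord : MonomialOrder σ} {J : Ideal (MvPolynomial σ K)} {b : ℕ}
  {u : Fin b → σ →₀ ℕ}

/-- The exponents of the leading monomials of the nonzero elements of `J`. -/
def initialExponents (ord : MonomialOrder σ) (J : Ideal (MvPolynomial σ K)) : Set (σ →₀ ℕ) :=
  {m | ∃ f ∈ J, f ≠ 0 ∧ ord.degree f = m}

/-- The initial ideal of `J` is generated in degree two. -/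
def IsQuadratic (ord : MonomialOrder σ) (J : Ideal (MvPolynomial σ K)) : Prop :=
  ∀ m ∈ initialExponents ord J, ∃ q ∈ initialExponents ord J, q.degree = 2 ∧ q ≤ m

theorem initialExponents_mono {m m' : σ →₀ ℕ} (hm : m ∈ initialExponents ord J) (h : m ≤ m') :
    m' ∈ initialExponents ord J := by
  obtain ⟨f, hf, hf0, rfl⟩ := hm
  obtain ⟨a, rfl⟩ := le_iff_exists_add'.1 h
  have ha : monomial a (1 : K) ≠ 0 := by simp
  refine ⟨monomial a 1 * f, J.mul_mem_left _ hf, mul_ne_zero ha hf0, ?_⟩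
  classical
  rw [ord.degree_mul ha hf0, ord.degree_monomial, if_neg one_ne_zero]

/-- If a variable times a monomial outside the initial ideal enters it, the reason is a quadratic
generator involving that variable. -/
theorem IsQuadratic.exists_single_add_single (hq : IsQuadratic ord J) {m : σ →₀ ℕ} {t : σ}
    (hm : m ∉ initialExponents ord J)
    (h : m + Finsupp.single t 1 ∈ initialExponents ord J) :
    ∃ s, m s ≠ 0 ∧ Finsupp.single s 1 + Finsupp.single t 1 ∈ initialExponents ord J := by
  classical
  obtain ⟨q, hqJ, hq2, hle⟩ := hq _ h
  have hqt : q t ≠ 0 := by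
    intro h0
    refine hm (initialExponents_mono hqJ fun s => ?_)
    by_cases hs : s = t
    · subst hs
      rw [h0]
      exact Nat.zero_le _
    · simpa [Finsupp.single_apply, Ne.symm hs] using hle s
  obtain ⟨r, rfl⟩ := exists_eq_add_single hqt
  have hr : r.degree = 1 := by simpa using hq2
  obtain ⟨s, hs⟩ := Finsupp.ne_iff.1 (show r ≠ 0 from fun h0 => by simp [h0] at hr)
  obtain ⟨r, rfl⟩ := exists_eq_add_single hs
  obtain rfl : r = 0 := (Finsupp.degree_eq_zero_iff r).1 (by simpa using hr)
  rw [zero_add] at hqJ hle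
  refine ⟨s, ?_, hqJ⟩
  have := (add_le_add_iff_right _).1 hle s
  simp only [Finsupp.single_eq_same] at this
  omega

/-- The position of the term `m e` of the free module on `Fin b`, where the basis element `e` is
given the monomial weight `u e`: terms are compared by their total weight `m + u e` first, and then
by their basis elements. -/
noncomputable def termKey (ord : MonomialOrder σ) (u : Fin b → σ →₀ ℕ) (m : σ →₀ ℕ) (e : Fin b) :
    ord.syn ×ₗ Fin b :=
  toLex (ord.toSyn (m + u e), e)

theorem termKey_injective {m m' : σ →₀ ℕ} {e e' : Fin b}
    (h : termKey ord u m e = termKey ord u m' e') : m = m' ∧ e = e' := by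
  have h1 := congrArg (fun x => (ofLex x).1) h
  have h2 := congrArg (fun x => (ofLex x).2) h
  simp only [termKey, ofLex_toLex, EmbeddingLike.apply_eq_iff_eq] at h1 h2
  subst h2
  exact ⟨add_right_cancel h1, rfl⟩

theorem termKey_add_le {m m' : σ →₀ ℕ} {e e' : Fin b}
    (h : termKey ord u m e ≤ termKey ord u m' e') (c : σ →₀ ℕ) :
    termKey ord u (c + m) e ≤ termKey ord u (c + m') e' := by
  rw [termKey, termKey, Prod.Lex.toLex_le_toLex] at h ⊢
  simp only [add_assoc, map_add ord.toSyn c, add_lt_add_iff_left, add_right_inj] at h ⊢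
  exact h

theorem termKey_le_of_toSyn_le {m m' : σ →₀ ℕ} (h : ord.toSyn m ≤ ord.toSyn m') (e : Fin b) :
    termKey ord u m e ≤ termKey ord u m' e := by
  rw [termKey, termKey, Prod.Lex.toLex_le_toLex]
  rcases h.lt_or_eq with h | h
  · exact Or.inl (by simpa using h)
  · exact Or.inr ⟨by simpa using h, le_rfl⟩

theorem toSyn_le_of_termKey_le {m m' : σ →₀ ℕ} {e : Fin b}
    (h : termKey ord u m e ≤ termKey ord u m' e) : ord.toSyn m ≤ ord.toSyn m' := by
  rw [termKey, termKey, Prod.Lex.toLex_le_toLex] at h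
  rcases h with h | h
  · exact le_of_lt (by simpa using h)
  · exact le_of_eq (by simpa using h.1)

/-- All terms of `F` have positions at most `κ`. -/
def TermsLE (ord : MonomialOrder σ) (u : Fin b → σ →₀ ℕ) (F : Fin b → MvPolynomial σ K)
    (κ : ord.syn ×ₗ Fin b) : Prop :=
  ∀ e m, coeff m (F e) ≠ 0 → termKey ord u m e ≤ κ

/-- All terms of `F` have positions less than `κ`. -/
def TermsLT (ord : MonomialOrder σ) (u : Fin b → σ →₀ ℕ) (F : Fin b → MvPolynomial σ K)
    (κ : ord.syn ×ₗ Fin b) : Prop :=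
  ∀ e m, coeff m (F e) ≠ 0 → termKey ord u m e < κ

theorem TermsLT.add {F F' : Fin b → MvPolynomial σ K} {κ : ord.syn ×ₗ Fin b}
    (h : TermsLT ord u F κ) (h' : TermsLT ord u F' κ) : TermsLT ord u (F + F') κ := by
  intro e m hm
  by_cases h0 : coeff m (F e) = 0
  · refine h' e m fun h1 => hm ?_
    rw [Pi.add_apply, coeff_add, h0, h1, add_zero]
  · exact h e m h0

/-- Two elements with the same leading coefficient at the same term differ by smaller terms. -/
theorem TermsLE.sub {F F' : Fin b → MvPolynomial σ K} {m : σ →₀ ℕ} {e : Fin b}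
    (h : TermsLE ord u F (termKey ord u m e)) (h' : TermsLE ord u F' (termKey ord u m e))
    (heq : coeff m (F e) = coeff m (F' e)) : TermsLT ord u (F - F') (termKey ord u m e) := by
  intro e' m' hm
  rw [Pi.sub_apply, coeff_sub] at hm
  refine lt_of_le_of_ne ?_ fun hkey => ?_
  · by_cases h0 : coeff m' (F e') = 0
    · exact h' e' m' fun h1 => hm (by rw [h0, h1, sub_zero])
    · exact h e' m' h0
  · obtain ⟨rfl, rfl⟩ := termKey_injective hkey
    exact hm (by rw [heq, sub_self])

theorem exists_leading_term (ord : MonomialOrder σ) (u : Fin b → σ →₀ ℕ)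
    {F : Fin b → MvPolynomial σ K} (hF : F ≠ 0) :
    ∃ m e, coeff m (F e) ≠ 0 ∧ TermsLE ord u F (termKey ord u m e) := by
  have hne : (Finset.univ.sigma fun e : Fin b => (F e).support).Nonempty := by
    by_contra hcon
    apply hF
    ext e m
    by_contra h0
    exact hcon ⟨⟨e, m⟩, by simpa using h0⟩
  obtain ⟨⟨e, m⟩, hm, hmax⟩ := Finset.exists_max_image _
    (fun q : (_ : Fin b) × (σ →₀ ℕ) => termKey ord u q.2 q.1) hne
  simp only [Finset.mem_sigma, Finset.mem_univ, true_and, mem_support_iff] at hm hmax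
  exact ⟨m, e, hm, fun e' m' h' => hmax ⟨e', m'⟩ h'⟩

theorem TermsLT.eq_zero_or {F : Fin b → MvPolynomial σ K} {κ : ord.syn ×ₗ Fin b}
    (h : TermsLT ord u F κ) : F = 0 ∨ ∃ κ' < κ, TermsLE ord u F κ' := by
  by_cases hF : F = 0
  · exact Or.inl hF
  · obtain ⟨m, e, hm, hle⟩ := exists_leading_term ord u hF
    exact Or.inr ⟨_, h e m hm, hle⟩

theorem TermsLE.monomial_mul {F : Fin b → MvPolynomial σ K} {m : σ →₀ ℕ} {e : Fin b}
    (h : TermsLE ord u F (termKey ord u m e)) (c : σ →₀ ℕ) (r : K) :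
    TermsLE ord u (fun e => monomial c r * F e) (termKey ord u (c + m) e) := by
  intro e' m' hm'
  rw [coeff_monomial_mul'] at hm'
  split_ifs at hm' with hc
  · obtain ⟨a, rfl⟩ := le_iff_exists_add.1 hc
    rw [add_tsub_cancel_left] at hm'
    exact termKey_add_le (h e' a (right_ne_zero_of_mul hm')) c
  · exact absurd rfl hm'

theorem termsLE_single {f : MvPolynomial σ K} (e : Fin b) (c : K) :
    TermsLE ord u (Pi.single e (C c * f)) (termKey ord u (ord.degree f) e) := by
  intro e' m hm
  by_cases he : e' = e
  · subst he
    rw [Pi.single_eq_same, coeff_C_mul] at hm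
    exact termKey_le_of_toSyn_le (ord.le_degree (mem_support_iff.2 (right_ne_zero_of_mul hm))) _
  · rw [Pi.single_eq_of_ne he, coeff_zero] at hm
    exact absurd rfl hm

/-! ### Lifting generators and syzygies -/

variable {c : ℕ} {p : Fin c → Fin b} {τ : Fin c → σ}
  {G : Matrix (Fin b) (Fin c) (MvPolynomial σ K)}

theorem mulVec_single_apply (G : Matrix (Fin b) (Fin c) (MvPolynomial σ K)) (i : Fin c)
    (f : MvPolynomial σ K) (e : Fin b) : G.mulVec (Pi.single i f) e = f * G e i := by
  simp [Matrix.mulVec_single, mul_comm]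

/-- The division algorithm: if every leading term of `U` is in the initial ideal of `J` or divisible
by the leading term of a column of `G`, then every element of `U` is, modulo `J`, a combination of
the columns of `G` whose terms do not exceed those of the given element. -/
theorem exists_mulVec_sub_mem {U : Submodule (MvPolynomial σ K) (Fin b → MvPolynomial σ K)}
    (hJ : ∀ F : Fin b → MvPolynomial σ K, (∀ e, F e ∈ J) → F ∈ U)
    (hG : ∀ i, (fun e => G e i) ∈ U)
    (hlead : ∀ F ∈ U, ∀ m e, coeff m (F e) ≠ 0 → TermsLE ord u F (termKey ord u m e) →
      m ∈ initialExponents ord J ∨ ∃ i, p i = e ∧ m (τ i) ≠ 0)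
    (hmonic : ∀ i, coeff (Finsupp.single (τ i) 1) (G (p i) i) = 1)
    (hterms : ∀ i, TermsLE ord u (fun e => G e i)
      (termKey ord u (Finsupp.single (τ i) 1) (p i)))
    (κ : ord.syn ×ₗ Fin b) {F : Fin b → MvPolynomial σ K} (hF : F ∈ U)
    (hle : TermsLE ord u F κ) :
    ∃ h : Fin c → MvPolynomial σ K, (∀ e, (G.mulVec h - F) e ∈ J) ∧
      ∀ i m, coeff m (h i) ≠ 0 → termKey ord u (m + Finsupp.single (τ i) 1) (p i) ≤ κ := by
  induction κ using WellFoundedLT.induction generalizing F with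
  | ind κ ih =>
    by_cases hF0 : F = 0
    · exact ⟨0, by simp [hF0], by simp⟩
    obtain ⟨m, e, hm, hlt⟩ := exists_leading_term ord u hF0
    have hκ : termKey ord u m e ≤ κ := hle e m hm
    -- It is enough to cancel the leading term of `F` by a suitable element of `U`.
    suffices h : ∃ F₀ ∈ U, ∃ h₀ : Fin c → MvPolynomial σ K, (∀ e, (G.mulVec h₀ - F₀) e ∈ J) ∧
        TermsLE ord u F₀ (termKey ord u m e) ∧ coeff m (F e) = coeff m (F₀ e) ∧
        ∀ i m', coeff m' (h₀ i) ≠ 0 →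
          termKey ord u (m' + Finsupp.single (τ i) 1) (p i) ≤ κ by
      obtain ⟨F₀, hF₀, h₀, hmem₀, hle₀, hcoeff, hκ₀⟩ := h
      rcases (hlt.sub hle₀ hcoeff).eq_zero_or with hzero | ⟨κ', hκ', hle'⟩
      · exact ⟨h₀, by rwa [sub_eq_zero.1 hzero], hκ₀⟩
      · obtain ⟨h₁, hmem₁, hκ₁⟩ := ih κ' (hκ'.trans_le hκ) (U.sub_mem hF hF₀) hle'
        refine ⟨h₀ + h₁, fun e => ?_, fun i m' hm' => ?_⟩
        · have : (G.mulVec (h₀ + h₁) - F) e =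
              (G.mulVec h₀ - F₀) e + (G.mulVec h₁ - (F - F₀)) e := by
            simp only [Matrix.mulVec_add, Pi.add_apply, Pi.sub_apply]
            ring
          rw [this]
          exact J.add_mem (hmem₀ e) (hmem₁ e)
        · by_cases h0 : coeff m' (h₀ i) = 0
          · refine (hκ₁ i m' fun h1 => hm' ?_).trans (hκ'.trans_le hκ).le
            rw [Pi.add_apply, coeff_add, h0, h1, add_zero]
          · exact hκ₀ i m' h0
    rcases hlead F hF m e hm hlt with ⟨f, hf, hf0, rfl⟩ | ⟨i, rfl, hi⟩
    · have hfe : ∀ e', (Pi.single e (C (coeff (ord.degree f) (F e) / ord.leadingCoeff f) * f) :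
          Fin b → MvPolynomial σ K) e' ∈ J := by
        intro e'
        by_cases he : e' = e
        · subst he
          rw [Pi.single_eq_same]
          exact J.mul_mem_left _ hf
        · rw [Pi.single_eq_of_ne he]
          exact J.zero_mem
      refine ⟨Pi.single e (C (coeff (ord.degree f) (F e) / ord.leadingCoeff f) * f),
        hJ _ hfe, 0, fun e' => ?_, termsLE_single e _, ?_, by simp⟩
      · rw [Matrix.mulVec_zero, zero_sub, Pi.neg_apply]
        exact J.neg_mem (hfe e')
      · rw [Pi.single_eq_same, coeff_C_mul]
        have hlc : ord.leadingCoeff f ≠ 0 := ord.leadingCoeff_ne_zero_iff.2 hf0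
        exact (div_mul_cancel₀ _ hlc).symm
    · obtain ⟨m₁, rfl⟩ := exists_eq_add_single hi
      refine ⟨fun e => monomial m₁ (coeff (m₁ + Finsupp.single (τ i) 1) (F (p i))) * G e i,
        U.smul_mem _ (hG i),
        Pi.single i (monomial m₁ (coeff (m₁ + Finsupp.single (τ i) 1) (F (p i)))),
        fun e => ?_, (hterms i).monomial_mul _ _, ?_, fun i' m' hm' => ?_⟩
      · rw [Pi.sub_apply, mulVec_single_apply, sub_self]
        exact J.zero_mem
      · rw [coeff_monomial_mul, hmonic, mul_one]
      · by_cases he : i' = i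
        · classical
          subst he
          rw [Pi.single_eq_same, coeff_monomial] at hm'
          have : m₁ = m' := by
            by_contra hne
            exact hm' (if_neg hne)
          exact this ▸ hκ
        · rw [Pi.single_eq_of_ne he, coeff_zero] at hm'
          exact absurd rfl hm'

end FreeModule

section Syzygies

variable {σ K : Type*} [Field K] [LinearOrder σ] {ord : MonomialOrder σ}
  {J : Ideal (MvPolynomial σ K)} {b : ℕ} {u : Fin b → σ →₀ ℕ}
  {c : ℕ} {p : Fin c → Fin b} {τ : Fin c → σ}

/-- The monomial weights of the basis of the next free module: the basis element mapped to an
element with leading term `x_τ e_p` gets the total weight of that term. -/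
noncomputable def nextShift (u : Fin b → σ →₀ ℕ) (p : Fin c → Fin b) (τ : Fin c → σ) :
    Fin c → σ →₀ ℕ :=
  fun i => u (p i) + Finsupp.single (τ i) 1

theorem termKey_nextShift_lt (hmono : ∀ i j, i < j → p i < p j ∨ p i = p j ∧ τ i < τ j)
    {m m' : σ →₀ ℕ} {i i' : Fin c}
    (h : termKey ord u (m + Finsupp.single (τ i) 1) (p i) <
      termKey ord u (m' + Finsupp.single (τ i') 1) (p i')) :
    termKey ord (nextShift u p τ) m i < termKey ord (nextShift u p τ) m' i' := by
  rw [termKey, termKey, Prod.Lex.toLex_lt_toLex] at h ⊢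
  simp only [nextShift, add_assoc, add_comm (Finsupp.single _ _) (u _)] at h ⊢
  refine h.imp_right fun h => ⟨h.1, ?_⟩
  by_contra hcon
  rcases (not_lt.1 hcon).lt_or_eq with hlt | heq
  · rcases hmono _ _ hlt with h1 | h1
    · exact lt_asymm h1 h.2
    · exact h.2.ne' h1.1
  · rw [heq] at h
    exact lt_irrefl _ h.2

theorem termKey_le_of_nextShift_le (hmono : ∀ i j, i < j → p i < p j ∨ p i = p j ∧ τ i < τ j)
    {m m' : σ →₀ ℕ} {i i' : Fin c}
    (h : termKey ord (nextShift u p τ) m i ≤ termKey ord (nextShift u p τ) m' i') :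
    termKey ord u (m + Finsupp.single (τ i) 1) (p i) ≤
      termKey ord u (m' + Finsupp.single (τ i') 1) (p i') := by
  by_contra hcon
  exact absurd (termKey_nextShift_lt hmono (not_le.1 hcon)) (not_lt_of_ge h)

theorem lt_of_termKey_nextShift_lt (hmono : ∀ i j, i < j → p i < p j ∨ p i = p j ∧ τ i < τ j)
    {m m' : σ →₀ ℕ} {i i' : Fin c}
    (h : termKey ord (nextShift u p τ) m i < termKey ord (nextShift u p τ) m' i')
    (heq : m + Finsupp.single (τ i) 1 = m' + Finsupp.single (τ i') 1) (hp : p i = p i') :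
    τ i < τ i' := by
  have hii : i < i' := by
    rw [termKey, termKey, Prod.Lex.toLex_lt_toLex] at h
    have h1 : m + nextShift u p τ i = m' + nextShift u p τ i' := by
      simp only [nextShift, hp, add_comm (u _), ← add_assoc, heq]
    rw [h1] at h
    exact (h.resolve_left (lt_irrefl _)).2
  rcases hmono _ _ hii with h1 | h1
  · exact absurd hp h1.ne
  · exact h1.2

variable {T : Fin b → Set σ} {G : Matrix (Fin b) (Fin c) (MvPolynomial σ K)}

/-- The variables that generate the next colon ideals: the preceding variables attached to the same
basis element, and those whose product with `x_τ` is in the initial ideal of `J`. -/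
def nextVars (ord : MonomialOrder σ) (J : Ideal (MvPolynomial σ K)) (T : Fin b → Set σ)
    (p : Fin c → Fin b) (τ : Fin c → σ) (i : Fin c) : Set σ :=
  {s | (s ∈ T (p i) ∧ s < τ i) ∨
    Finsupp.single s 1 + Finsupp.single (τ i) 1 ∈ initialExponents ord J}

/-- The leading terms of the syzygies: a term `m e_i` with `m` outside the initial ideal and not
divisible by the variables of `nextVars` cannot be cancelled. -/
theorem mem_initialExponents_or_of_mulVec_mem (hq : IsQuadratic ord J)
    (hmono : ∀ i j, i < j → p i < p j ∨ p i = p j ∧ τ i < τ j) (hT : ∀ i, τ i ∈ T (p i))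
    (hmonic : ∀ i, coeff (Finsupp.single (τ i) 1) (G (p i) i) = 1)
    (hterms : ∀ i, TermsLE ord u (fun e => G e i)
      (termKey ord u (Finsupp.single (τ i) 1) (p i)))
    {h : Fin c → MvPolynomial σ K} (hmem : ∀ e, G.mulVec h e ∈ J) {m : σ →₀ ℕ} {i : Fin c}
    (hm : coeff m (h i) ≠ 0)
    (hlead : TermsLE ord (nextShift u p τ) h (termKey ord (nextShift u p τ) m i)) :
    m ∈ initialExponents ord J ∨ ∃ s ∈ nextVars ord J T p τ i, m s ≠ 0 := by
  by_contra! hcon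
  obtain ⟨hmJ, hvars⟩ := hcon
  have hnot : m + Finsupp.single (τ i) 1 ∉ initialExponents ord J := by
    intro hin
    obtain ⟨s, hs, hsJ⟩ := hq.exists_single_add_single hmJ hin
    exact hs (hvars s (Or.inr hsJ))
  -- The terms of `G h`, written as a sum over the terms of `h`.
  have hexp : ∀ e a, coeff a (G.mulVec h e) =
      ∑ i', ∑ m' ∈ (h i').support, coeff a (monomial m' (coeff m' (h i')) * G e i') := by
    intro e a
    rw [Matrix.mulVec, dotProduct, coeff_sum]
    refine Finset.sum_congr rfl fun i' _ => ?_
    rw [← coeff_sum, ← Finset.sum_mul, support_sum_monomial_coeff, mul_comm]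
  have hbound : ∀ i' m', coeff m' (h i') ≠ 0 → ∀ e a,
      coeff a (monomial m' (coeff m' (h i')) * G e i') ≠ 0 →
      termKey ord u a e ≤ termKey ord u (m' + Finsupp.single (τ i') 1) (p i') :=
    fun i' m' _ e a ha => (hterms i').monomial_mul m' _ e a ha
  have hle : TermsLE ord u (G.mulVec h) (termKey ord u (m + Finsupp.single (τ i) 1) (p i)) := by
    intro e a ha
    rw [hexp] at ha
    obtain ⟨i', -, ha⟩ := Finset.exists_ne_zero_of_sum_ne_zero ha
    obtain ⟨m', hm', ha⟩ := Finset.exists_ne_zero_of_sum_ne_zero ha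
    rw [mem_support_iff] at hm'
    exact (hbound i' m' hm' e a ha).trans
      (termKey_le_of_nextShift_le hmono (hlead i' m' hm'))
  have hcoeff : coeff (m + Finsupp.single (τ i) 1) (G.mulVec h (p i)) = coeff m (h i) := by
    have hzero : ∀ i' m', coeff m' (h i') ≠ 0 → ¬ (m' = m ∧ i' = i) →
        coeff (m + Finsupp.single (τ i) 1)
          (monomial m' (coeff m' (h i')) * G (p i) i') = 0 := by
      intro i' m' hm' hne
      by_contra h0
      have hlt : termKey ord (nextShift u p τ) m' i' < termKey ord (nextShift u p τ) m i :=
        lt_of_le_of_ne (hlead i' m' hm') fun heq => hne (termKey_injective heq)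
      have heq := le_antisymm (hbound i' m' hm' _ _ h0) (termKey_le_of_nextShift_le hmono hlt.le)
      obtain ⟨heq, hp⟩ := termKey_injective heq
      have hτ := lt_of_termKey_nextShift_lt hmono hlt heq.symm hp.symm
      refine absurd (hvars (τ i') (Or.inl ⟨hp ▸ hT i', hτ⟩)) ?_
      have := DFunLike.congr_fun heq (τ i')
      simp only [Finsupp.add_apply, Finsupp.single_eq_same,
        Finsupp.single_eq_of_ne hτ.ne] at this
      omega
    rw [hexp, Finset.sum_eq_single i, Finset.sum_eq_single m]
    · rw [coeff_monomial_mul, hmonic, mul_one]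
    · exact fun m' hm' hne => hzero i m' (mem_support_iff.1 hm') fun h => hne h.1
    · exact fun h => absurd (mem_support_iff.2 hm) h
    · exact fun i' _ hne => Finset.sum_eq_zero fun m' hm' =>
        hzero i' m' (mem_support_iff.1 hm') fun h => hne h.2
    · exact fun h => absurd (Finset.mem_univ i) h
  have hsupp : m + Finsupp.single (τ i) 1 ∈ (G.mulVec h (p i)).support := by
    rw [mem_support_iff, hcoeff]
    exact hm
  refine hnot ⟨_, hmem (p i), fun h0 => by simp [h0] at hsupp, ?_⟩
  refine ord.toSyn.injective (le_antisymm ?_ (ord.le_degree hsupp))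
  refine ord.degree_le_iff.2 fun a ha => ?_
  exact toSyn_le_of_termKey_le (hle (p i) a (mem_support_iff.1 ha))

/-- Every variable of `nextVars` is the leading term of a syzygy modulo `J`: reduce the product of
the variable with a column of `G`, or an S-polynomial of two columns, by the division algorithm. -/
theorem exists_syzygy {U : Submodule (MvPolynomial σ K) (Fin b → MvPolynomial σ K)}
    (hJ : ∀ F : Fin b → MvPolynomial σ K, (∀ e, F e ∈ J) → F ∈ U)
    (hG : ∀ i, (fun e => G e i) ∈ U)
    (hlead : ∀ F ∈ U, ∀ m e, coeff m (F e) ≠ 0 → TermsLE ord u F (termKey ord u m e) →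
      m ∈ initialExponents ord J ∨ ∃ i, p i = e ∧ m (τ i) ≠ 0)
    (hmono : ∀ i j, i < j → p i < p j ∨ p i = p j ∧ τ i < τ j)
    (hsurj : ∀ e, ∀ t ∈ T e, ∃ i, p i = e ∧ τ i = t)
    (hmonic : ∀ i, coeff (Finsupp.single (τ i) 1) (G (p i) i) = 1)
    (hterms : ∀ i, TermsLE ord u (fun e => G e i)
      (termKey ord u (Finsupp.single (τ i) 1) (p i)))
    {i : Fin c} {s : σ} (hs : s ∈ nextVars ord J T p τ i) :
    ∃ h : Fin c → MvPolynomial σ K, (∀ e, G.mulVec h e ∈ J) ∧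
      coeff (Finsupp.single s 1) (h i) = 1 ∧
      TermsLE ord (nextShift u p τ) h
        (termKey ord (nextShift u p τ) (Finsupp.single s 1) i) := by
  set κ := termKey ord (nextShift u p τ) (Finsupp.single s 1) i with hκ
  -- It is enough to find an element of `U` with smaller terms which is the image of the basis
  -- element `i` times `x_s` up to `J` and to the image of smaller terms.
  suffices h : ∃ F ∈ U, ∃ h₀ : Fin c → MvPolynomial σ K,
      TermsLT ord u F
        (termKey ord u (Finsupp.single s 1 + Finsupp.single (τ i) 1) (p i)) ∧
      TermsLT ord (nextShift u p τ) h₀ κ ∧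
      ∀ e, (G.mulVec (Pi.single i (monomial (Finsupp.single s 1) 1)) - G.mulVec h₀ - F) e ∈ J by
    obtain ⟨F, hF, h₀, hFlt, hlt₀, hmem⟩ := h
    have hdiv : ∃ h₁ : Fin c → MvPolynomial σ K, (∀ e, (G.mulVec h₁ - F) e ∈ J) ∧
        TermsLT ord (nextShift u p τ) h₁ κ := by
      rcases hFlt.eq_zero_or with rfl | ⟨κ', hκ', hle'⟩
      · exact ⟨0, by simp, fun e m hm => absurd (coeff_zero m) hm⟩
      · obtain ⟨h₁, hmem₁, hle₁⟩ :=
          exists_mulVec_sub_mem hJ hG hlead hmonic hterms κ' hF hle'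
        exact ⟨h₁, hmem₁, fun i' m' hm' =>
          termKey_nextShift_lt hmono ((hle₁ i' m' hm').trans_lt hκ')⟩
    obtain ⟨h₁, hmem₁, hlt₁⟩ := hdiv
    have hlow := hlt₀.add hlt₁
    refine ⟨Pi.single i (monomial (Finsupp.single s 1) 1) - (h₀ + h₁), fun e => ?_, ?_, ?_⟩
    · have : G.mulVec (Pi.single i (monomial (Finsupp.single s 1) 1) - (h₀ + h₁)) e =
          (G.mulVec (Pi.single i (monomial (Finsupp.single s 1) 1)) - G.mulVec h₀ - F) e -
            (G.mulVec h₁ - F) e := by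
        simp only [Matrix.mulVec_sub, Matrix.mulVec_add, Pi.add_apply, Pi.sub_apply]
        ring
      rw [this]
      exact J.sub_mem (hmem e) (hmem₁ e)
    · have h0 : coeff (Finsupp.single s 1) ((h₀ + h₁) i) = 0 := by
        by_contra h0
        exact lt_irrefl _ (hlow i _ h0)
      rw [Pi.sub_apply, coeff_sub, h0, Pi.single_eq_same, coeff_monomial, if_pos rfl, sub_zero]
    · intro i' m' hm'
      by_cases h0 : coeff m' ((h₀ + h₁) i') = 0
      · rw [Pi.sub_apply, coeff_sub, h0, sub_zero] at hm'
        by_cases hi : i' = i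
        · subst hi
          rw [Pi.single_eq_same, coeff_monomial] at hm'
          have : Finsupp.single s 1 = m' := by
            by_contra hne
            exact hm' (if_neg hne)
          rw [← this]
        · rw [Pi.single_eq_of_ne hi, coeff_zero] at hm'
          exact absurd rfl hm'
      · exact (hlow i' m' h0).le
  have hcol : ∀ i (s : σ), G.mulVec (Pi.single i (monomial (Finsupp.single s 1) 1)) =
      fun e => monomial (Finsupp.single s 1) (1 : K) * G e i :=
    fun i s => funext fun e => mulVec_single_apply G i _ e
  rcases hs with ⟨hsT, hst⟩ | ⟨f, hf, hf0, hfd⟩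
  · obtain ⟨j, hj, rfl⟩ := hsurj _ s hsT
    have hji : j < i := by
      by_contra hcon
      rcases (not_lt.1 hcon).lt_or_eq with hlt | rfl
      · rcases hmono _ _ hlt with h1 | h1
        · exact h1.ne' hj
        · exact lt_asymm h1.2 hst
      · exact lt_irrefl _ hst
    have hcomm : Finsupp.single (τ j) 1 + Finsupp.single (τ i) 1 =
        Finsupp.single (τ i) 1 + Finsupp.single (τ j) 1 := add_comm _ _
    refine ⟨_, U.sub_mem (U.smul_mem (monomial (Finsupp.single (τ j) 1) (1 : K)) (hG i))
        (U.smul_mem (monomial (Finsupp.single (τ i) 1) (1 : K)) (hG j)),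
      Pi.single j (monomial (Finsupp.single (τ i) 1) 1), ?_, ?_, fun e => ?_⟩
    · refine TermsLE.sub ((hterms i).monomial_mul _ _) ?_ ?_
      · rw [← hj, hcomm]
        exact (hterms j).monomial_mul _ _
      · simp only [Pi.smul_apply, smul_eq_mul]
        rw [coeff_monomial_mul, hmonic, hcomm, coeff_monomial_mul, ← hj, hmonic]
    · intro i' m' hm'
      by_cases hi : i' = j
      · subst hi
        rw [Pi.single_eq_same, coeff_monomial] at hm'
        have : Finsupp.single (τ i) 1 = m' := by
          by_contra hne
          exact hm' (if_neg hne)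
        rw [hκ, ← this, termKey, termKey, Prod.Lex.toLex_lt_toLex]
        refine Or.inr ⟨?_, hji⟩
        simp only [nextShift, hj, add_left_comm _ (u (p i)), hcomm]
      · rw [Pi.single_eq_of_ne hi, coeff_zero] at hm'
        exact absurd rfl hm'
    · rw [hcol, hcol]
      simp
  · have hlc : ord.leadingCoeff f ≠ 0 := ord.leadingCoeff_ne_zero_iff.2 hf0
    have hfe : ∀ e', (Pi.single (p i) (C (ord.leadingCoeff f)⁻¹ * f) :
        Fin b → MvPolynomial σ K) e' ∈ J := by
      intro e'
      by_cases he : e' = p i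
      · subst he
        rw [Pi.single_eq_same]
        exact J.mul_mem_left _ hf
      · rw [Pi.single_eq_of_ne he]
        exact J.zero_mem
    refine ⟨_, U.sub_mem (U.smul_mem (monomial (Finsupp.single s 1) (1 : K)) (hG i))
      (hJ _ hfe), 0, ?_, fun i' m' hm' => absurd (coeff_zero m') hm', fun e => ?_⟩
    · refine TermsLE.sub ((hterms i).monomial_mul _ _) ?_ ?_
      · rw [← hfd]
        exact termsLE_single _ _
      · simp only [Pi.smul_apply, smul_eq_mul]
        rw [coeff_monomial_mul, hmonic, Pi.single_eq_same, coeff_C_mul, ← hfd, mul_one]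
        exact (inv_mul_cancel₀ hlc).symm
    · rw [hcol]
      simpa using hfe e

end Syzygies

/-! ### The linear resolution of the residue field -/

section Resolution

variable {σ K : Type*} [Field K]

theorem homogeneousComponent_succ_mul {a : MvPolynomial σ K} (ha : a.IsHomogeneous 1) (k : ℕ)
    (f : MvPolynomial σ K) :
    homogeneousComponent (k + 1) (a * f) = a * homogeneousComponent k f := by
  have hk : ∀ l, homogeneousComponent (k + 1) (a * homogeneousComponent l f) =
      if k = l then a * homogeneousComponent l f else 0 := by
    intro l
    have := ha.mul (homogeneousComponent_isHomogeneous l f)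
    rw [homogeneousComponent_of_mem (n := 1 + l) this]
    exact if_congr (by omega) rfl rfl
  conv_lhs => rw [← sum_homogeneousComponent f]
  rw [Finset.mul_sum, map_sum, Finset.sum_congr rfl fun l _ => hk l, Finset.sum_ite_eq]
  split_ifs with h
  · rfl
  · rw [homogeneousComponent_eq_zero, mul_zero]
    simpa [Nat.lt_succ_iff] using h

theorem IsQuadratic.constantCoeff_eq_zero {ord : MonomialOrder σ}
    {J : Ideal (MvPolynomial σ K)} (hq : IsQuadratic ord J)
    (hhom : ∀ f ∈ J, ∀ k, homogeneousComponent k f ∈ J) {f : MvPolynomial σ K} (hf : f ∈ J) :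
    constantCoeff f = 0 := by
  by_contra h0
  have h1 := hhom f hf 0
  rw [homogeneousComponent_zero] at h1
  have h2 : C (coeff 0 f) ≠ (0 : MvPolynomial σ K) := fun h => h0 (C_eq_zero.1 h)
  obtain ⟨q, -, hq2, hle⟩ := hq 0 ⟨_, h1, h2, by simp⟩
  rw [nonpos_iff_eq_zero.1 hle] at hq2
  simp at hq2

/-- A homogeneous module of syzygies over `K[σ] / J`, described by its preimage `module` in a free
`K[σ]`-module of finite rank, with terms ordered by the weights `shift` of the basis. Its leading
terms are those in the initial ideal of `J` and the multiples of the terms `x_t e` with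
`t ∈ vars e`, and each `x_t e` is the leading term of an element. -/
structure LinearSyzygies [LinearOrder σ] (ord : MonomialOrder σ)
    (J : Ideal (MvPolynomial σ K)) where
  /-- The rank of the free module. -/
  rank : ℕ
  /-- The monomial weights of the basis. -/
  shift : Fin rank → σ →₀ ℕ
  /-- The variables that occur in the leading terms of the generators at a basis element. -/
  vars : Fin rank → Set σ
  /-- The module of syzygies. -/
  module : Submodule (MvPolynomial σ K) (Fin rank → MvPolynomial σ K)
  mem_of_forall_mem : ∀ F : Fin rank → MvPolynomial σ K, (∀ e, F e ∈ J) → F ∈ module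
  homogeneousComponent_mem : ∀ F ∈ module, ∀ k,
    (fun e => homogeneousComponent k (F e)) ∈ module
  leading : ∀ F ∈ module, ∀ m e, coeff m (F e) ≠ 0 →
    TermsLE ord shift F (termKey ord shift m e) →
    m ∈ initialExponents ord J ∨ ∃ t ∈ vars e, m t ≠ 0
  exists_leading : ∀ e, ∀ t ∈ vars e, ∃ F ∈ module, coeff (Finsupp.single t 1) (F e) = 1 ∧
    TermsLE ord shift F (termKey ord shift (Finsupp.single t 1) e)

variable [LinearOrder σ] {ord : MonomialOrder σ} {J : Ideal (MvPolynomial σ K)}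

/-- The leading generators may be chosen homogeneous, by passing to their components of degree
one. -/
theorem LinearSyzygies.exists_homogeneous (L : LinearSyzygies ord J) (e : Fin L.rank) {t : σ}
    (ht : t ∈ L.vars e) : ∃ F ∈ L.module, (∀ e', (F e').IsHomogeneous 1) ∧
      coeff (Finsupp.single t 1) (F e) = 1 ∧
      TermsLE ord L.shift F (termKey ord L.shift (Finsupp.single t 1) e) := by
  obtain ⟨F, hF, h1, hle⟩ := L.exists_leading e t ht
  refine ⟨_, L.homogeneousComponent_mem F hF 1,
    fun e' => homogeneousComponent_isHomogeneous 1 (F e'), ?_, fun e' m hm => hle e' m ?_⟩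
  · rw [coeff_homogeneousComponent, if_pos (by simp), h1]
  · rw [coeff_homogeneousComponent] at hm
    exact fun h0 => hm (by simp [h0])

/-- The generators of a module of syzygies with linear leading terms have such a module of syzygies
again. -/
theorem LinearSyzygies.exists_next [Finite σ] (hq : IsQuadratic ord J)
    (hhom : ∀ f ∈ J, ∀ k, homogeneousComponent k f ∈ J) (L : LinearSyzygies ord J) :
    ∃ (L' : LinearSyzygies ord J) (G : Matrix (Fin L.rank) (Fin L'.rank) (MvPolynomial σ K)),
      (∀ e i, (G e i).IsHomogeneous 1) ∧
      (∀ F, F ∈ L.module ↔ ∃ h, ∀ e, (G.mulVec h - F) e ∈ J) ∧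
      ∀ h, h ∈ L'.module ↔ ∀ e, G.mulVec h e ∈ J := by
  classical
  have hfin : {q : Fin L.rank ×ₗ σ | (ofLex q).2 ∈ L.vars (ofLex q).1}.Finite := by
    have : Finite (Fin L.rank ×ₗ σ) := inferInstanceAs (Finite (Fin L.rank × σ))
    exact Set.toFinite _
  set s := hfin.toFinset with hs
  -- The basis of the next free module, in lexicographic order.
  let ψ : Fin s.card ↪o Fin L.rank ×ₗ σ := s.orderEmbOfFin rfl
  let p : Fin s.card → Fin L.rank := fun i => (ofLex (ψ i)).1
  let τ : Fin s.card → σ := fun i => (ofLex (ψ i)).2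
  have hT : ∀ i, τ i ∈ L.vars (p i) := fun i =>
    hfin.mem_toFinset.1 (s.orderEmbOfFin_mem rfl i)
  have hsurj : ∀ e, ∀ t ∈ L.vars e, ∃ i, p i = e ∧ τ i = t := by
    intro e t ht
    have : toLex (e, t) ∈ Set.range ψ := by
      rw [Finset.range_orderEmbOfFin, Finset.mem_coe, hs, Set.Finite.mem_toFinset]
      exact ht
    obtain ⟨i, hi⟩ := this
    exact ⟨i, by simp [p, hi], by simp [τ, hi]⟩
  have hmono : ∀ i j, i < j → p i < p j ∨ p i = p j ∧ τ i < τ j := fun i j hij =>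
    Prod.Lex.lt_iff.1 (ψ.strictMono hij)
  choose g hgU hghom hmonic hterms using fun i => L.exists_homogeneous (p i) (hT i)
  let G : Matrix (Fin L.rank) (Fin s.card) (MvPolynomial σ K) := Matrix.of fun e i => g i e
  have hGhom : ∀ e i, (G e i).IsHomogeneous 1 := fun e i => hghom i e
  have hlead : ∀ F ∈ L.module, ∀ m e, coeff m (F e) ≠ 0 →
      TermsLE ord L.shift F (termKey ord L.shift m e) →
      m ∈ initialExponents ord J ∨ ∃ i, p i = e ∧ m (τ i) ≠ 0 := by
    intro F hF m e hm hle
    refine (L.leading F hF m e hm hle).imp_right ?_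
    rintro ⟨t, ht, hmt⟩
    obtain ⟨i, hi, rfl⟩ := hsurj e t ht
    exact ⟨i, hi, hmt⟩
  have hmem : ∀ h : Fin s.card → MvPolynomial σ K,
      h ∈ (Submodule.pi Set.univ fun _ : Fin L.rank => J).comap G.mulVecLin ↔
        ∀ e, G.mulVec h e ∈ J := by
    intro h
    simp [Submodule.mem_pi]
  refine ⟨{
    rank := s.card
    shift := nextShift L.shift p τ
    vars := nextVars ord J L.vars p τ
    module := (Submodule.pi Set.univ fun _ : Fin L.rank => J).comap G.mulVecLin
    mem_of_forall_mem := fun F hF => (hmem F).2 fun e => by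
      rw [Matrix.mulVec, dotProduct]
      exact J.sum_mem fun i _ => J.mul_mem_left _ (hF i)
    homogeneousComponent_mem := fun F hF k => (hmem _).2 fun e => ?_
    leading := fun F hF m i hm hle => mem_initialExponents_or_of_mulVec_mem hq hmono hT hmonic
      hterms ((hmem F).1 hF) hm hle
    exists_leading := fun i t ht => ?_ }, G, hGhom, fun F => ⟨fun hF => ?_, ?_⟩,
      hmem⟩
  · have h1 := hhom _ ((hmem F).1 hF e) (k + 1)
    rw [Matrix.mulVec, dotProduct, map_sum] at h1
    rw [Matrix.mulVec, dotProduct]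
    simpa only [homogeneousComponent_succ_mul (hGhom e _)] using h1
  · obtain ⟨h, h1, h2, h3⟩ := exists_syzygy L.mem_of_forall_mem hgU hlead hmono hsurj hmonic
      hterms ht
    exact ⟨h, (hmem h).2 h1, h2, h3⟩
  · by_cases hF0 : F = 0
    · exact ⟨0, by simp [hF0]⟩
    obtain ⟨m, e, -, hle⟩ := exists_leading_term ord L.shift hF0
    obtain ⟨h, hh, -⟩ := exists_mulVec_sub_mem (G := G) L.mem_of_forall_mem hgU hlead hmonic hterms
      _ hF hle
    exact ⟨h, hh⟩
  · rintro ⟨h, hh⟩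
    have h1 : G.mulVec h ∈ L.module := by
      have : G.mulVec h = ∑ i, h i • g i := by
        ext1 e
        simp [Matrix.mulVec, dotProduct, G, mul_comm]
      rw [this]
      exact L.module.sum_mem fun i _ => L.module.smul_mem _ (hgU i)
    have h2 := L.module.sub_mem h1 (L.mem_of_forall_mem _ hh)
    rwa [sub_sub_cancel] at h2

/-- The first module of syzygies: the ideal generated by the variables. -/
noncomputable def LinearSyzygies.augmentation (hJ : ∀ f ∈ J, constantCoeff f = 0) :
    LinearSyzygies ord J where
  rank := 1
  shift := 0
  vars _ := Set.univ
  module := Submodule.pi Set.univ fun _ => RingHom.ker (constantCoeff (R := K) (σ := σ))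
  mem_of_forall_mem F hF := by
    simp only [Submodule.mem_pi, Set.mem_univ, true_imp_iff, RingHom.mem_ker]
    exact fun e => hJ _ (hF e)
  homogeneousComponent_mem F hF k := by
    simp only [Submodule.mem_pi, Set.mem_univ, true_imp_iff, RingHom.mem_ker,
      constantCoeff_eq] at hF ⊢
    intro e
    rw [coeff_homogeneousComponent, hF e, ite_self]
  leading F hF m e hm _ := by
    refine Or.inr ?_
    simp only [Submodule.mem_pi, Set.mem_univ, true_imp_iff, RingHom.mem_ker,
      constantCoeff_eq] at hF
    have hne : m ≠ 0 := by
      rintro rfl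
      exact hm (hF e)
    obtain ⟨t, ht⟩ := Finsupp.ne_iff.1 hne
    exact ⟨t, Set.mem_univ t, ht⟩
  exists_leading e t _ := by
    refine ⟨fun _ => monomial (Finsupp.single t 1) 1, ?_, ?_, fun e' m hm => ?_⟩
    · simp [Submodule.mem_pi, RingHom.mem_ker, constantCoeff_eq, coeff_monomial]
    · rw [coeff_monomial, if_pos rfl]
    · rw [coeff_monomial] at hm
      have : Finsupp.single t 1 = m := by
        by_contra hne
        exact hm (if_neg hne)
      rw [← this, Subsingleton.elim e' e]

end Resolution

/-! ### Quotients with a quadratic initial ideal are Koszul -/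

section Koszul

variable {σ K : Type*} [Field K]

/-- The grading of `K[σ] / J` by the classes of homogeneous polynomials. -/
noncomputable def quotientGrading (J : Ideal (MvPolynomial σ K)) (k : ℕ) :
    Submodule K (MvPolynomial σ K ⧸ J) :=
  (homogeneousSubmodule σ K k).map (Ideal.Quotient.mkₐ K J).toLinearMap

variable {J : Ideal (MvPolynomial σ K)}

theorem mem_quotientGrading_iff {k : ℕ} {a : MvPolynomial σ K ⧸ J} :
    a ∈ quotientGrading J k ↔ ∃ f : MvPolynomial σ K, f.IsHomogeneous k ∧
      Ideal.Quotient.mk J f = a :=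
  Iff.rfl

theorem mk_mem_quotientGrading {k : ℕ} {f : MvPolynomial σ K} (hf : f.IsHomogeneous k) :
    Ideal.Quotient.mk J f ∈ quotientGrading J k :=
  ⟨f, hf, rfl⟩

theorem gradedMonoid_quotientGrading : SetLike.GradedMonoid (quotientGrading J) where
  one_mem := ⟨1, isHomogeneous_one σ K, rfl⟩
  mul_mem := by
    rintro i j _ _ ⟨f, hf, rfl⟩ ⟨g, hg, rfl⟩
    exact ⟨f * g, hf.mul hg, rfl⟩

theorem quotientGrading_zero :
    quotientGrading J 0 = LinearMap.range (Algebra.linearMap K (MvPolynomial σ K ⧸ J)) := by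
  ext a
  rw [mem_quotientGrading_iff, LinearMap.mem_range]
  constructor
  · rintro ⟨f, hf, rfl⟩
    have : f = C (coeff 0 f) := by
      conv_lhs => rw [← homogeneousComponent_eq_self hf, homogeneousComponent_zero]
    exact ⟨coeff 0 f, by rw [this]; simp; rfl⟩
  · rintro ⟨c, rfl⟩
    exact ⟨C c, isHomogeneous_C σ c, rfl⟩

/-- The projection of `K[σ] / J` to the classes of degree `k`. -/
noncomputable def quotientComponent (hhom : ∀ f ∈ J, ∀ k, homogeneousComponent k f ∈ J) (k : ℕ) :
    (MvPolynomial σ K ⧸ J) →ₗ[K] (MvPolynomial σ K ⧸ J) :=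
  (J.restrictScalars K).mapQ (J.restrictScalars K) (homogeneousComponent k)
    fun f hf => hhom f hf k

theorem quotientComponent_of_mem (hhom : ∀ f ∈ J, ∀ k, homogeneousComponent k f ∈ J) {k l : ℕ}
    {a : MvPolynomial σ K ⧸ J} (ha : a ∈ quotientGrading J l) :
    quotientComponent hhom k a = if k = l then a else 0 := by
  obtain ⟨f, hf, rfl⟩ := ha
  change Ideal.Quotient.mk J (homogeneousComponent k f) = _
  rw [homogeneousComponent_of_mem hf]
  split_ifs
  · rfl
  · exact map_zero _

theorem isInternal_quotientGrading (hhom : ∀ f ∈ J, ∀ k, homogeneousComponent k f ∈ J) :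
    DirectSum.IsInternal (quotientGrading J) := by
  classical
  constructor
  · rw [injective_iff_map_eq_zero]
    intro x hx
    ext k
    have h1 : ∀ y : DirectSum ℕ fun i => quotientGrading J i,
        quotientComponent hhom k (DirectSum.coeAddMonoidHom (quotientGrading J) y) = y k := by
      intro y
      induction y using DirectSum.induction_on with
      | zero => simp
      | of i a =>
        rw [DirectSum.coeAddMonoidHom_of, quotientComponent_of_mem hhom a.2]
        split_ifs with h
        · subst h
          rw [DirectSum.of_eq_same]
        · rw [DirectSum.of_eq_of_ne _ _ _ h]
          rfl
      | add y z hy hz => simp [hy, hz]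
    rw [← h1 x, hx, map_zero]
    rfl
  · intro a
    obtain ⟨f, rfl⟩ := Ideal.Quotient.mk_surjective a
    refine ⟨∑ i ∈ Finset.range (f.totalDegree + 1), DirectSum.of (fun i => quotientGrading J i) i
      ⟨_, mk_mem_quotientGrading (homogeneousComponent_isHomogeneous i f)⟩, ?_⟩
    rw [map_sum]
    simp only [DirectSum.coeAddMonoidHom_of]
    rw [← map_sum, sum_homogeneousComponent]

theorem mk_mem_positivePart_iff (hJ : ∀ f ∈ J, constantCoeff f = 0) (f : MvPolynomial σ K) :
    Ideal.Quotient.mk J f ∈ positivePart (quotientGrading J) ↔ constantCoeff f = 0 := by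
  constructor
  · intro hf
    have hle : positivePart (quotientGrading J) ≤
        (RingHom.ker (constantCoeff (R := K) (σ := σ))).map (Ideal.Quotient.mk J) := by
      refine Ideal.span_le.2 (Set.iUnion_subset fun k => ?_)
      rintro _ ⟨g, hg, rfl⟩
      refine Ideal.mem_map_of_mem _ ?_
      rw [RingHom.mem_ker, constantCoeff_eq]
      by_contra h0
      have := hg h0
      simp at this
    obtain ⟨g, hg, hgf⟩ :=
      (Ideal.mem_map_iff_of_surjective _ Ideal.Quotient.mk_surjective).1 (hle hf)
    have h1 := hJ _ (Ideal.Quotient.eq.1 hgf)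
    rw [map_sub, (RingHom.mem_ker).1 hg, zero_sub, neg_eq_zero] at h1
    exact h1
  · intro hf
    rw [← sum_homogeneousComponent f, map_sum]
    refine Ideal.sum_mem _ fun i _ => ?_
    rcases i with _ | i
    · rw [homogeneousComponent_zero, ← constantCoeff_eq, hf]
      simp
    · exact Ideal.subset_span (Set.mem_iUnion.2
        ⟨i, mk_mem_quotientGrading (homogeneousComponent_isHomogeneous _ f)⟩)

theorem mulVec_map_mk {b c : ℕ} (G : Matrix (Fin b) (Fin c) (MvPolynomial σ K))
    (h : Fin c → MvPolynomial σ K) :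
    (G.map (Ideal.Quotient.mk J)).mulVec (fun i => Ideal.Quotient.mk J (h i)) =
      fun e => Ideal.Quotient.mk J (G.mulVec h e) := by
  ext e
  simp [Matrix.mulVec, dotProduct]

theorem exists_eq_mk_comp {b : ℕ} (v : Fin b → MvPolynomial σ K ⧸ J) :
    ∃ h : Fin b → MvPolynomial σ K, v = fun i => Ideal.Quotient.mk J (h i) := by
  choose h hh using fun i => Ideal.Quotient.mk_surjective (v i)
  exact ⟨h, funext fun i => (hh i).symm⟩

variable {ord : MonomialOrder σ}

theorem IsQuadratic.hasLinearResolution [LinearOrder σ] [Finite σ] (hq : IsQuadratic ord J)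
    (hhom : ∀ f ∈ J, ∀ k, homogeneousComponent k f ∈ J) :
    HasLinearResolution (quotientGrading J) := by
  have hJ : ∀ f ∈ J, constantCoeff f = 0 := fun f hf => hq.constantCoeff_eq_zero hhom hf
  choose next G hG hrange hker using fun L : LinearSyzygies ord J => L.exists_next hq hhom
  let L : ℕ → LinearSyzygies ord J :=
    fun k => Nat.rec (LinearSyzygies.augmentation hJ) (fun _ => next) k
  -- The image of `d p` consists of the classes of the elements of the module `L p`.
  have himage : ∀ p (h : Fin (L p).rank → MvPolynomial σ K),
      h ∈ (L p).module ↔ (fun i => Ideal.Quotient.mk J (h i)) ∈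
        Set.range ((G (L p)).map (Ideal.Quotient.mk J)).mulVecLin := by
    intro p h
    rw [hrange]
    constructor
    · rintro ⟨v, hv⟩
      refine ⟨fun i => Ideal.Quotient.mk J (v i), ?_⟩
      rw [Matrix.mulVecLin_apply, mulVec_map_mk]
      exact funext fun e => Ideal.Quotient.eq.2 (hv e)
    · rintro ⟨v, hv⟩
      obtain ⟨v, rfl⟩ := exists_eq_mk_comp v
      rw [Matrix.mulVecLin_apply, mulVec_map_mk] at hv
      exact ⟨v, fun e => Ideal.Quotient.eq.1 (congrFun hv e)⟩
  refine ⟨fun p => (L p).rank, fun p => (G (L p)).map (Ideal.Quotient.mk J),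
    (positivePart (quotientGrading J)).mkQ.comp (LinearMap.proj (0 : Fin 1)),
    fun p r c => mk_mem_quotientGrading (hG _ r c), ?_, fun v => ?_, fun p v => ?_⟩
  · intro a
    obtain ⟨a, rfl⟩ := Submodule.Quotient.mk_surjective _ a
    exact ⟨fun _ => a, rfl⟩
  · obtain ⟨h, rfl⟩ := exists_eq_mk_comp v
    rw [← himage 0]
    change Submodule.Quotient.mk (Ideal.Quotient.mk J (h (0 : Fin 1))) =
      (0 : _ ⧸ positivePart (quotientGrading J)) ↔ _
    rw [Submodule.Quotient.mk_eq_zero, mk_mem_positivePart_iff hJ]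
    change _ ↔ h ∈ Submodule.pi Set.univ fun _ : Fin 1 =>
      RingHom.ker (constantCoeff (R := K) (σ := σ))
    exact ⟨fun h0 i _ => Subsingleton.elim i (0 : Fin 1) ▸ h0,
      fun h0 => h0 (0 : Fin 1) (Set.mem_univ _)⟩
  · obtain ⟨h, rfl⟩ := exists_eq_mk_comp v
    rw [← himage (p + 1)]
    change _ ↔ h ∈ (next (L p)).module
    rw [hker, Matrix.mulVecLin_apply]
    rw [mulVec_map_mk (G (L p)) h]
    exact _root_.funext_iff.trans (forall_congr' fun e => Ideal.Quotient.eq_zero_iff_mem)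

theorem IsQuadratic.isKoszul [LinearOrder σ] [Finite σ] (hq : IsQuadratic ord J)
    (hhom : ∀ f ∈ J, ∀ k, homogeneousComponent k f ∈ J) : IsKoszul (quotientGrading J) where
  nontrivial := by
    refine Ideal.Quotient.nontrivial_iff.2 fun h => ?_
    have := hq.constantCoeff_eq_zero hhom (f := 1) (h ▸ Submodule.mem_top)
    simp at this
  gradedMonoid := gradedMonoid_quotientGrading
  isInternal := isInternal_quotientGrading hhom
  zero_eq := quotientGrading_zero
  hasLinearResolution := hq.hasLinearResolution hhom

end Koszul

/-! ### The toric ideal of a two-Borel ideal -/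

section Toric

variable {n : ℕ} {K : Type*} [Field K] {M N : Fin n →₀ ℕ}

/-- The generators have the same positive degree, so the multidegree of a monomial determines its
degree, and the toric ideal is homogeneous. -/
theorem homogeneousComponent_mem_toricIdeal (hdeg : M.degree = N.degree) (hpos : 0 < M.degree)
    {f : ToricSource (borelIdeal K {M, N})} (hf : f ∈ toricIdeal (borelIdeal K {M, N})) (k : ℕ) :
    homogeneousComponent k f ∈ toricIdeal (borelIdeal K {M, N}) := by
  have hmap : toricMap (borelIdeal K {M, N}) (homogeneousComponent k f) =
      homogeneousComponent (k * M.degree) (toricMap (borelIdeal K {M, N}) f) := by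
    clear hf
    induction f using MvPolynomial.induction_on' with
    | monomial Z c =>
      rw [toricMap_monomial,
        homogeneousComponent_of_mem (n := Z.degree) (isHomogeneous_monomial c rfl),
        homogeneousComponent_of_mem (n := Z.degree * M.degree)
          (isHomogeneous_monomial c (degree_multidegree hdeg Z))]
      have hiff : k * M.degree = Z.degree * M.degree ↔ k = Z.degree :=
        ⟨Nat.eq_of_mul_eq_mul_right hpos, fun h => h ▸ rfl⟩
      simp only [hiff]
      split_ifs
      · rw [toricMap_monomial]
      · exact map_zero _
    | add p q hp hq => simp only [map_add, hp, hq]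
  rw [toricIdeal, RingHom.mem_ker] at hf ⊢
  change toricMap (borelIdeal K {M, N}) (homogeneousComponent k f) = 0
  rw [hmap]
  rw [show toricMap (borelIdeal K {M, N}) f = 0 from hf, map_zero]

theorem isQuadratic_toricIdeal (hdeg : M.degree = N.degree) (hpos : 0 < M.degree) :
    IsQuadratic (fiberSinkOrder K M N) (toricIdeal (borelIdeal K {M, N})) := by
  rintro _ ⟨f, hf, hf0, rfl⟩
  obtain ⟨g, -, hg, hg0, -, hg2, hle⟩ := exists_quadricBinomial_degree_le hdeg hpos hf hf0
  exact ⟨_, ⟨g, hg, hg0, rfl⟩, hg2, hle⟩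

theorem isKoszul_toricGrading (hdeg : M.degree = N.degree) (hpos : 0 < M.degree) :
    IsKoszul (toricGrading (borelIdeal K {M, N})) :=
  letI := fiberSinkVarOrder K M N
  (isQuadratic_toricIdeal hdeg hpos).isKoszul fun _ hf k =>
    homogeneousComponent_mem_toricIdeal hdeg hpos hf k

end Toric

end TwoBorel

theorem theorem5p12 {K : Type*} [Field K] {n : ℕ} (M N : Fin n →₀ ℕ)
    (hdeg : M.degree = N.degree) (hpos : 0 < M.degree) :
    (∃ G : Set (TwoBorel.ToricSource (TwoBorel.borelIdeal K {M, N})),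
      (∀ f ∈ G, TwoBorel.IsQuadricBinomial f) ∧
      TwoBorel.IsGroebnerBasis (TwoBorel.fiberSinkOrder K M N) G
        (TwoBorel.toricIdeal (TwoBorel.borelIdeal K {M, N}))) ∧
    TwoBorel.IsKoszul (TwoBorel.toricGrading (TwoBorel.borelIdeal K {M, N})) ∧
    (∀ μ : Fin n →₀ ℕ, (TwoBorel.fiber (TwoBorel.borelIdeal K {M, N}) μ).Nonempty →
      ∃! Z : TwoBorel.fiber (TwoBorel.borelIdeal K {M, N}) μ,
        TwoBorel.IsSink (TwoBorel.fiberDigraph (TwoBorel.borelIdeal K {M, N})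
          (TwoBorel.fiberSinkOrder K M N) μ) Z) := by
  refine ⟨⟨TwoBorel.quadricBinomials _, ?_,
    TwoBorel.isGroebnerBasis_quadricBinomials hdeg hpos⟩,
    TwoBorel.isKoszul_toricGrading hdeg hpos,
    fun μ hμ => TwoBorel.existsUnique_isSink hdeg hpos hμ⟩
  rintro _ ⟨a, b, ha, hb, hab, -, rfl⟩
  exact ⟨a, b, ha, hb, hab, rfl⟩
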